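/- **Setting.** Consider the plant $\dot x = Ax+Bu+B_ww$, $z = Cx+Du+D_ww$ with $x\in\mathbb R^n$, $u\in\mathbb R^m$, $z\in\mathbb R^r$, constant exogenous signal $w\in\mathcal W\subset\mathbb R^{n_w}$, $\mathcal W$ convex and compact, and $A$ Hurwitz. Let $G_u=-CA^{-1}B+D$, $G_w=-CA^{-1}B_w+D_w$. For $H_z\in\mathbb R^{n_c\times r}$, $H_u\in\mathbb R^{n_c\times m}$, $H_w\in\mathbb R^{n_c\times n_w}$ and convex functions $f_0:\mathcal U\to\mathbb R$, $g_0:\mathcal Z\to\mathbb R$ on convex sets $\mathcal U\subseteq\mathbb R^m$, $\mathcal Z\subseteq\mathbb R^r$, continuously differentiable with locally Lipschitz gradients on the interiors $\mathcal U^\circ,\mathcal Z^\circ$, consider $$\min_{\bar u\in\mathcal U,\ \bar z\in\mathcal Z} f_0(\bar u)+g_0(\bar z)\quad\text{s.t.}\quad \bar z=G_u\bar u+G_ww,\qquad 0=H_z\bar z+H_u\bar u+H_ww. \tag{1}$$ Assume that for each $w\in\mathcal W$ problem (1) has an optimal point in $\mathcal U^\circ\times\mathcal Z^\circ$. **Controller.**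 Let $T_z\in\mathbb R^{r\times q}$, $T_u\in\mathbb R^{m\times q}$ be such that the range of $\begin{bmatrix}T_z\\T_u\end{bmatrix}$ is the null space of $\begin{bmatrix}I_r&-G_u\\H_z&H_u\end{bmatrix}$. For $K=[K_1\ K_2]\in\mathbb R^{m\times(q+n_c)}$ and $\tau_1,\tau_2>0$ the controller is $$\tau_1\dot\eta_1=-T_u^{\mathsf T}\nabla f_0(u)-T_z^{\mathsf T}\nabla g_0(z),\qquad \tau_2\dot\eta_2=-(H_zz+H_uu+H_ww),\qquad u=K_1\eta_1+K_2\eta_2. \tag{2}$$ The closed-loop dynamics are considered where $u\in\mathcal U^\circ$ and $z\in\mathcal Z^\circ$. The controller *solves the OSS problem* if for each $w\in\mathcal W$ the closed loop has exactly one equilibrium point, this equilibrium is locally exponentially stable, and its pair $(\bar u,\bar z)$ is an optimal point of (1). **LMI.** Let $Q_1,Q_2\succeq0$ and let $\tilde f_0,\tilde g_0$ be convex and differentiable on $\mathcal U^\circ$ and $\mathcal Z^\circ$ with $\nabla f_0(u)=Q_1u+\nabla\tilde f_0(u)$ and $\nabla g_0(z)=Q_2z+\nabla\tilde g_0(z)$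 there. Put $\Delta_1=\nabla\tilde f_0$, $\Delta_2=\nabla\tilde g_0$, $d_1=m$, $d_2=r$. For $i=1,2$ let $\Theta_i\in\mathbb R^{2d_i\times2d_i}$ be a symmetric, nonsingular block $2\times 2$ matrix whose upper left $d_i\times d_i$ block is negative semidefinite and which satisfies the incremental sector constraint $$\begin{bmatrix}\Delta_i(v)-\Delta_i(v')\\v-v'\end{bmatrix}^{\mathsf T}\Theta_i\begin{bmatrix}\Delta_i(v)-\Delta_i(v')\\v-v'\end{bmatrix}\ge0$$ for all $v,v'\in\mathcal U^\circ$ ($i=1$), respectively $v,v'\in\mathcal Z^\circ$ ($i=2$). For $\theta_1,\theta_2>0$ let $\Theta$ be the matrix of the quadratic form in $(p_1,p_2,q_1,q_2)$ given by $\sum_i\theta_i^{-1}\begin{bmatrix}p_i\\q_i\end{bmatrix}^{\mathsf T}\Theta_i\begin{bmatrix}p_i\\q_i\end{bmatrix}$. Fix $\rho,\gamma>0$, put $N=H_zG_u+H_u$, $\tilde N=H_zG_w+H_w$, $Q=T_u^{\mathsf T}Q_1+T_z^{\mathsf T}Q_2G_u$, $\mathcal A=0$, $\mathcal C_1=0$,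 $\mathcal C_2=0$, $\mathcal D_1=0$, $$\mathcal B=\begin{bmatrix}-Q\\-N\end{bmatrix},\ \mathcal B_1=\mathcal D_{21}=\begin{bmatrix}-T_u^{\mathsf T}&-T_z^{\mathsf T}\\0&0\end{bmatrix},\ \mathcal B_2=\begin{bmatrix}-T_z^{\mathsf T}Q_2G_w\\-\tilde N\end{bmatrix},\ \mathcal E_1=\begin{bmatrix}I_m\\G_u\end{bmatrix},\ \mathcal D_{12}=\begin{bmatrix}0\\G_w\end{bmatrix},\ \mathcal E_2=\begin{bmatrix}-Q\\-\rho N\end{bmatrix},\ \mathcal D_2=\begin{bmatrix}-T_z^{\mathsf T}Q_2G_w\\-\rho\tilde N\end{bmatrix}.$$ The robust synthesis LMI in $Y=Y^{\mathsf T}\succ0$, $Z\in\mathbb R^{m\times(q+n_c)}$ and $\theta_1,\theta_2>0$ is $$W^{\mathsf T}\,\mathrm{diag}\!\left(\begin{bmatrix}0&-I_{q+n_c}\\-I_{q+n_c}&0\end{bmatrix},\,-\Theta^{-1},\,I_{n_w},\,-\gamma^2I_{q+n_c}\right)W\prec0, \tag{3}$$ $$W=\begin{bmatrix}-(\mathcal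 AY+\mathcal BZ)^{\mathsf T}&-(\mathcal C_1Y+\mathcal E_1Z)^{\mathsf T}&-(\mathcal C_2Y+\mathcal E_2Z)^{\mathsf T}\\I_{q+n_c}&0&0\\-\mathcal B_1^{\mathsf T}&-\mathcal D_1^{\mathsf T}&-\mathcal D_{21}^{\mathsf T}\\0&I_{m+r}&0\\-\mathcal B_2^{\mathsf T}&-\mathcal D_{12}^{\mathsf T}&-\mathcal D_2^{\mathsf T}\\0&0&I_{q+n_c}\end{bmatrix}.$$ **Proposition (Robust Optimal Stabilizer).** Let $(Y,Z,\theta_1,\theta_2)$ be feasible for (3) and set $K=ZY^{-1}$. Then there is $\tau^\star>0$ such that for every $\tau\ge\tau^\star$ the controller (2) with this $K$ and $\tau_1=\tau_2=\tau$ solves the OSS problem. -/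

import Mathlib

open Matrix Set

noncomputable section

namespace OSS

/-- A real matrix all of whose (complex) eigenvalues have negative real part. -/
def IsHurwitz {n : ℕ} (A : Matrix (Fin n) (Fin n) ℝ) : Prop :=
  ∀ s ∈ spectrum ℂ (A.map (algebraMap ℝ ℂ)), s.re < 0

/-- The data of an optimal steady-state control problem: the LTI plant
`x' = A x + B u + Bw w`, `z = C x + D u + Dw w`, the engineering constraint matrices
`Hz, Hu, Hw`, the domains `Uset`, `Zset` of the objective functions, the objective functions
`f₀`, `g₀` (only their values on `Uset`, `Zset` matter), and the set `Wset` of constant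
exogenous signals. -/
structure Data (n m r nc nw : ℕ) where
  A : Matrix (Fin n) (Fin n) ℝ
  B : Matrix (Fin n) (Fin m) ℝ
  Bw : Matrix (Fin n) (Fin nw) ℝ
  C : Matrix (Fin r) (Fin n) ℝ
  D : Matrix (Fin r) (Fin m) ℝ
  Dw : Matrix (Fin r) (Fin nw) ℝ
  Hz : Matrix (Fin nc) (Fin r) ℝ
  Hu : Matrix (Fin nc) (Fin m) ℝ
  Hw : Matrix (Fin nc) (Fin nw) ℝ
  Uset : Set (EuclideanSpace ℝ (Fin m))
  Zset : Set (EuclideanSpace ℝ (Fin r))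
  f₀ : EuclideanSpace ℝ (Fin m) → ℝ
  g₀ : EuclideanSpace ℝ (Fin r) → ℝ
  Wset : Set (EuclideanSpace ℝ (Fin nw))

namespace Data

variable {n m r nc nw q : ℕ} (S : Data n m r nc nw)

/-- DC gain from `u` to `z`. -/
def Gu : Matrix (Fin r) (Fin m) ℝ := -(S.C * S.A⁻¹ * S.B) + S.D

/-- DC gain from `w` to `z`. -/
def Gw : Matrix (Fin r) (Fin nw) ℝ := -(S.C * S.A⁻¹ * S.Bw) + S.Dw

def N : Matrix (Fin nc) (Fin m) ℝ := S.Hz * S.Gu + S.Hu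

def Ntilde : Matrix (Fin nc) (Fin nw) ℝ := S.Hz * S.Gw + S.Hw

/-- Left side of the engineering constraints. -/
def violation (w : EuclideanSpace ℝ (Fin nw)) (u : EuclideanSpace ℝ (Fin m))
    (z : EuclideanSpace ℝ (Fin r)) : EuclideanSpace ℝ (Fin nc) :=
  toEuclideanLin S.Hz z + toEuclideanLin S.Hu u + toEuclideanLin S.Hw w

/-- Feasible points of the steady-state optimization problem. -/
def IsFeasible (w : EuclideanSpace ℝ (Fin nw)) (u : EuclideanSpace ℝ (Fin m))
    (z : EuclideanSpace ℝ (Fin r)) : Prop :=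
  u ∈ S.Uset ∧ z ∈ S.Zset ∧ z = toEuclideanLin S.Gu u + toEuclideanLin S.Gw w ∧
    S.violation w u z = 0

/-- Global minimizers of `f₀(u) + g₀(z)` over the feasible points. -/
def IsOptimal (w : EuclideanSpace ℝ (Fin nw)) (u : EuclideanSpace ℝ (Fin m))
    (z : EuclideanSpace ℝ (Fin r)) : Prop :=
  S.IsFeasible w u z ∧
    ∀ u' z', S.IsFeasible w u' z' → S.f₀ u + S.g₀ z ≤ S.f₀ u' + S.g₀ z'

/-- Standing assumptions on the problem data. -/
structure StandingAssumptions : Prop where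
  hurwitz : IsHurwitz S.A
  convex_f : ConvexOn ℝ S.Uset S.f₀
  convex_g : ConvexOn ℝ S.Zset S.g₀
  contDiff_f : ContDiffOn ℝ 1 S.f₀ (interior S.Uset)
  contDiff_g : ContDiffOn ℝ 1 S.g₀ (interior S.Zset)
  lipschitz_f : LocallyLipschitzOn (interior S.Uset) (gradient S.f₀)
  lipschitz_g : LocallyLipschitzOn (interior S.Zset) (gradient S.g₀)
  convex_W : Convex ℝ S.Wset
  compact_W : IsCompact S.Wset
  exists_optimal : ∀ w ∈ S.Wset, ∃ u ∈ interior S.Uset, ∃ z ∈ interior S.Zset,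
    S.IsOptimal w u z

/-- The columns of `T = [Tz; Tu]` span the null space of `[I, -Gu; Hz, Hu]`. -/
def SpansConstraintKernel (Tz : Matrix (Fin r) (Fin q) ℝ) (Tu : Matrix (Fin m) (Fin q) ℝ) :
    Prop :=
  LinearMap.range (fromRows Tz Tu).mulVecLin
    = LinearMap.ker (fromBlocks 1 (-S.Gu) S.Hz S.Hu).mulVecLin

/-! ### The closed loop -/

/-- State `(x, η₁, η₂)` of the closed loop. -/
abbrev State (n q nc : ℕ) : Type :=
  EuclideanSpace ℝ (Fin n) × EuclideanSpace ℝ (Fin q) × EuclideanSpace ℝ (Fin nc)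

/-- Control input `u = K₁ η₁ + K₂ η₂`, where `K = [K₁ K₂]`. -/
def input (K : Matrix (Fin m) (Fin q ⊕ Fin nc) ℝ) (ξ : State n q nc) :
    EuclideanSpace ℝ (Fin m) :=
  toEuclideanLin K.toCols₁ ξ.2.1 + toEuclideanLin K.toCols₂ ξ.2.2

/-- Measured output `z = C x + D u + Dw w` of the closed loop. -/
def output (K : Matrix (Fin m) (Fin q ⊕ Fin nc) ℝ) (w : EuclideanSpace ℝ (Fin nw))
    (ξ : State n q nc) : EuclideanSpace ℝ (Fin r) :=
  toEuclideanLin S.C ξ.1 + toEuclideanLin S.D (input K ξ) + toEuclideanLin S.Dw w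

/-- States at which the closed-loop dynamics are defined: those for which `u` and `z` are
interior to the domains of `f₀` and `g₀`. -/
def domain (K : Matrix (Fin m) (Fin q ⊕ Fin nc) ℝ) (w : EuclideanSpace ℝ (Fin nw)) :
    Set (State n q nc) :=
  {ξ | input K ξ ∈ interior S.Uset ∧ S.output K w ξ ∈ interior S.Zset}

/-- Right side of the closed-loop differential equation: the plant with the controller
`τ₁ η₁' = -(Tuᵀ ∇f₀(u) + Tzᵀ ∇g₀(z))`, `τ₂ η₂' = -(Hz z + Hu u + Hw w)`,
`u = K₁ η₁ + K₂ η₂`. -/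
def closedLoop (Tz : Matrix (Fin r) (Fin q) ℝ) (Tu : Matrix (Fin m) (Fin q) ℝ)
    (K : Matrix (Fin m) (Fin q ⊕ Fin nc) ℝ) (τ₁ τ₂ : ℝ) (w : EuclideanSpace ℝ (Fin nw))
    (ξ : State n q nc) : State n q nc :=
  (toEuclideanLin S.A ξ.1 + toEuclideanLin S.B (input K ξ) + toEuclideanLin S.Bw w,
   -(τ₁⁻¹ • (toEuclideanLin Tuᵀ (gradient S.f₀ (input K ξ))
      + toEuclideanLin Tzᵀ (gradient S.g₀ (S.output K w ξ)))),
   -(τ₂⁻¹ • S.violation w (input K ξ) (S.output K w ξ)))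

end Data

/-- `x` solves `x' = F(x)` on `[0, ∞)` and stays in the domain `dom` of `F`. -/
def IsSolution {E : Type*} [NormedAddCommGroup E] [NormedSpace ℝ E] (F : E → E) (dom : Set E)
    (x : ℝ → E) : Prop :=
  ∀ t, 0 ≤ t → x t ∈ dom ∧ HasDerivWithinAt x (F (x t)) (Ici 0) t

/-- Equilibrium points of `x' = F(x)`. -/
def IsEquilibrium {E : Type*} [NormedAddCommGroup E] [NormedSpace ℝ E] (F : E → E)
    (dom : Set E) (p : E) : Prop :=
  p ∈ dom ∧ F p = 0

/-- Local exponential stability of `p` for `x' = F(x)`: from every initial state close to `p`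
a solution exists for all times, and it converges exponentially to `p`. -/
def IsLocallyExpStable {E : Type*} [NormedAddCommGroup E] [NormedSpace ℝ E] (F : E → E)
    (dom : Set E) (p : E) : Prop :=
  ∃ c > 0, ∃ lam > 0, ∃ δ > 0, ∀ x₀ : E, ‖x₀ - p‖ < δ →
    (∃ x : ℝ → E, IsSolution F dom x ∧ x 0 = x₀) ∧
    ∀ x : ℝ → E, IsSolution F dom x → x 0 = x₀ →
      ∀ t, 0 ≤ t → ‖x t - p‖ ≤ c * Real.exp (-lam * t) * ‖x₀ - p‖

namespace Data

variable {n m r nc nw q : ℕ} (S : Data n m r nc nw)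

/-- The controller solves the OSS control problem: for each `w`, the closed loop has exactly
one equilibrium point, it is locally exponentially stable, and the corresponding pair `(u, z)`
is an optimal point. -/
def SolvesOSS (Tz : Matrix (Fin r) (Fin q) ℝ) (Tu : Matrix (Fin m) (Fin q) ℝ)
    (K : Matrix (Fin m) (Fin q ⊕ Fin nc) ℝ) (τ₁ τ₂ : ℝ) : Prop :=
  ∀ w ∈ S.Wset, ∃ p : State n q nc,
    IsEquilibrium (S.closedLoop Tz Tu K τ₁ τ₂ w) (S.domain K w) p ∧
    (∀ p', IsEquilibrium (S.closedLoop Tz Tu K τ₁ τ₂ w) (S.domain K w) p' → p' = p) ∧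
    IsLocallyExpStable (S.closedLoop Tz Tu K τ₁ τ₂ w) (S.domain K w) p ∧
    S.IsOptimal w (input K p) (S.output K w p)

end Data

/-! ### Quadratic parts and incremental sector constraints -/

/-- On the interior of `s` one has `∇f(v) = Q v + ∇ft(v)` with `Q ⪰ 0` and `ft` convex and
differentiable. -/
def IsQuadraticSplit {k : ℕ} (s : Set (EuclideanSpace ℝ (Fin k)))
    (f ft : EuclideanSpace ℝ (Fin k) → ℝ) (Q : Matrix (Fin k) (Fin k) ℝ) : Prop :=
  Q.PosSemidef ∧ ConvexOn ℝ (interior s) ft ∧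
    ∀ v ∈ interior s, DifferentiableAt ℝ ft v ∧
      gradient f v = toEuclideanLin Q v + gradient ft v

/-- The incremental pointwise sector constraint
`[Δ(v) - Δ(v'); v - v']ᵀ Θ [Δ(v) - Δ(v'); v - v'] ≥ 0` for all `v, v'` in `s`. -/
def SectorConstraint {k : ℕ} (s : Set (EuclideanSpace ℝ (Fin k)))
    (Δ : EuclideanSpace ℝ (Fin k) → EuclideanSpace ℝ (Fin k))
    (Θ : Matrix (Fin k ⊕ Fin k) (Fin k ⊕ Fin k) ℝ) : Prop :=
  ∀ v ∈ s, ∀ v' ∈ s,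
    0 ≤ (Sum.elim (Δ v - Δ v').ofLp (v - v').ofLp) ⬝ᵥ
      (Θ *ᵥ (Sum.elim (Δ v - Δ v').ofLp (v - v').ofLp))

/-- `Θ` is a sector multiplier for `Δ` on `s`: symmetric, nonsingular, with negative
semidefinite upper left block, and the incremental sector constraint holds. This includes
`Θ = [0, 1; 1, 0] ⊗ I` (monotone `Δ`), `[-2, L; L, 0] ⊗ I`, `[0, 1; 1, -2μ] ⊗ I` and
`[-2, μ + L; μ + L, -2 μ L] ⊗ I` with `μ < L`, the usual choices for gradients of functions
that are convex, convex with `L`-Lipschitz gradient, `μ`-strongly convex, or both. -/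
structure IsSectorMultiplier {k : ℕ} (s : Set (EuclideanSpace ℝ (Fin k)))
    (Δ : EuclideanSpace ℝ (Fin k) → EuclideanSpace ℝ (Fin k))
    (Θ : Matrix (Fin k ⊕ Fin k) (Fin k ⊕ Fin k) ℝ) : Prop where
  symm : Θ.IsSymm
  nonsing : IsUnit Θ.det
  upperLeft : (-Θ.toBlocks₁₁).PosSemidef
  sector : SectorConstraint s Δ Θ

/-- Diagonal augmentation of two block two-by-two matrices: the matrix of the sum of the two
quadratic forms, in the variables ordered as `(p₁, p₂, q₁, q₂)`. -/
def daug {k l : ℕ} (Θ₁ : Matrix (Fin k ⊕ Fin k) (Fin k ⊕ Fin k) ℝ)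
    (Θ₂ : Matrix (Fin l ⊕ Fin l) (Fin l ⊕ Fin l) ℝ) :
    Matrix ((Fin k ⊕ Fin l) ⊕ (Fin k ⊕ Fin l)) ((Fin k ⊕ Fin l) ⊕ (Fin k ⊕ Fin l)) ℝ :=
  fromBlocks
    (fromBlocks Θ₁.toBlocks₁₁ 0 0 Θ₂.toBlocks₁₁) (fromBlocks Θ₁.toBlocks₁₂ 0 0 Θ₂.toBlocks₁₂)
    (fromBlocks Θ₁.toBlocks₂₁ 0 0 Θ₂.toBlocks₂₁) (fromBlocks Θ₁.toBlocks₂₂ 0 0 Θ₂.toBlocks₂₂)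

/-! ### Linear-fractional representation of the reduced dynamics -/

namespace Data

variable {n m r nc nw q : ℕ} (S : Data n m r nc nw)

/-- `Q = Tuᵀ Q₁ + Tzᵀ Q₂ Gu`. -/
def Qred (Tz : Matrix (Fin r) (Fin q) ℝ) (Tu : Matrix (Fin m) (Fin q) ℝ)
    (Q₁ : Matrix (Fin m) (Fin m) ℝ) (Q₂ : Matrix (Fin r) (Fin r) ℝ) :
    Matrix (Fin q) (Fin m) ℝ :=
  Tuᵀ * Q₁ + Tzᵀ * Q₂ * S.Gu

def lfrA (q nc : ℕ) : Matrix (Fin q ⊕ Fin nc) (Fin q ⊕ Fin nc) ℝ := 0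

def lfrB (Tz : Matrix (Fin r) (Fin q) ℝ) (Tu : Matrix (Fin m) (Fin q) ℝ)
    (Q₁ : Matrix (Fin m) (Fin m) ℝ) (Q₂ : Matrix (Fin r) (Fin r) ℝ) :
    Matrix (Fin q ⊕ Fin nc) (Fin m) ℝ :=
  fromRows (-S.Qred Tz Tu Q₁ Q₂) (-S.N)

def lfrB₁ (nc : ℕ) (Tz : Matrix (Fin r) (Fin q) ℝ) (Tu : Matrix (Fin m) (Fin q) ℝ) :
    Matrix (Fin q ⊕ Fin nc) (Fin m ⊕ Fin r) ℝ :=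
  fromRows (fromCols (-Tuᵀ) (-Tzᵀ)) 0

def lfrB₂ (Tz : Matrix (Fin r) (Fin q) ℝ) (Q₂ : Matrix (Fin r) (Fin r) ℝ) :
    Matrix (Fin q ⊕ Fin nc) (Fin nw) ℝ :=
  fromRows (-(Tzᵀ * Q₂ * S.Gw)) (-S.Ntilde)

def lfrC₁ (m r q nc : ℕ) : Matrix (Fin m ⊕ Fin r) (Fin q ⊕ Fin nc) ℝ := 0

def lfrE₁ : Matrix (Fin m ⊕ Fin r) (Fin m) ℝ := fromRows 1 S.Gu

def lfrD₁ (m r : ℕ) : Matrix (Fin m ⊕ Fin r) (Fin m ⊕ Fin r) ℝ := 0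

def lfrD₁₂ : Matrix (Fin m ⊕ Fin r) (Fin nw) ℝ := fromRows 0 S.Gw

def lfrC₂ (q nc : ℕ) : Matrix (Fin q ⊕ Fin nc) (Fin q ⊕ Fin nc) ℝ := 0

def lfrE₂ (Tz : Matrix (Fin r) (Fin q) ℝ) (Tu : Matrix (Fin m) (Fin q) ℝ)
    (Q₁ : Matrix (Fin m) (Fin m) ℝ) (Q₂ : Matrix (Fin r) (Fin r) ℝ) (ρ : ℝ) :
    Matrix (Fin q ⊕ Fin nc) (Fin m) ℝ :=
  fromRows (-S.Qred Tz Tu Q₁ Q₂) (-(ρ • S.N))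

def lfrD₂₁ (nc : ℕ) (Tz : Matrix (Fin r) (Fin q) ℝ) (Tu : Matrix (Fin m) (Fin q) ℝ) :
    Matrix (Fin q ⊕ Fin nc) (Fin m ⊕ Fin r) ℝ :=
  fromRows (fromCols (-Tuᵀ) (-Tzᵀ)) 0

def lfrD₂ (Tz : Matrix (Fin r) (Fin q) ℝ) (Q₂ : Matrix (Fin r) (Fin r) ℝ) (ρ : ℝ) :
    Matrix (Fin q ⊕ Fin nc) (Fin nw) ℝ :=
  fromRows (-(Tzᵀ * Q₂ * S.Gw)) (-(ρ • S.Ntilde))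

/-- The middle factor of the synthesis matrix inequality:
`diag([0, -I; -I, 0], -Θ⁻¹, I, -γ² I)`. -/
def lmiInner (nw q nc : ℕ) (γ : ℝ)
    (Θ : Matrix ((Fin m ⊕ Fin r) ⊕ (Fin m ⊕ Fin r)) ((Fin m ⊕ Fin r) ⊕ (Fin m ⊕ Fin r)) ℝ) :
    Matrix
      ((((Fin q ⊕ Fin nc) ⊕ (Fin q ⊕ Fin nc)) ⊕ ((Fin m ⊕ Fin r) ⊕ (Fin m ⊕ Fin r))) ⊕
        (Fin nw ⊕ (Fin q ⊕ Fin nc)))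
      ((((Fin q ⊕ Fin nc) ⊕ (Fin q ⊕ Fin nc)) ⊕ ((Fin m ⊕ Fin r) ⊕ (Fin m ⊕ Fin r))) ⊕
        (Fin nw ⊕ (Fin q ⊕ Fin nc))) ℝ :=
  fromBlocks
    (fromBlocks (fromBlocks 0 (-1) (-1) 0) 0 0 (-Θ⁻¹)) 0
    0 (fromBlocks 1 0 0 (-(γ ^ 2 • (1 : Matrix (Fin q ⊕ Fin nc) (Fin q ⊕ Fin nc) ℝ))))

/-- The outer factor of the synthesis matrix inequality. -/
def lmiOuter (Tz : Matrix (Fin r) (Fin q) ℝ) (Tu : Matrix (Fin m) (Fin q) ℝ)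
    (Q₁ : Matrix (Fin m) (Fin m) ℝ) (Q₂ : Matrix (Fin r) (Fin r) ℝ) (ρ : ℝ)
    (Y : Matrix (Fin q ⊕ Fin nc) (Fin q ⊕ Fin nc) ℝ) (Z : Matrix (Fin m) (Fin q ⊕ Fin nc) ℝ) :
    Matrix
      ((((Fin q ⊕ Fin nc) ⊕ (Fin q ⊕ Fin nc)) ⊕ ((Fin m ⊕ Fin r) ⊕ (Fin m ⊕ Fin r))) ⊕
        (Fin nw ⊕ (Fin q ⊕ Fin nc)))
      (((Fin q ⊕ Fin nc) ⊕ (Fin m ⊕ Fin r)) ⊕ (Fin q ⊕ Fin nc)) ℝ :=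
  fromRows
    (fromRows
      (fromRows
        (fromCols (fromCols
          (-(lfrA q nc * Y + S.lfrB Tz Tu Q₁ Q₂ * Z)ᵀ)
          (-(lfrC₁ m r q nc * Y + S.lfrE₁ * Z)ᵀ))
          (-(lfrC₂ q nc * Y + S.lfrE₂ Tz Tu Q₁ Q₂ ρ * Z)ᵀ))
        (fromCols (fromCols 1 0) 0))
      (fromRows
        (fromCols (fromCols (-(lfrB₁ nc Tz Tu)ᵀ) (-(lfrD₁ m r)ᵀ)) (-(lfrD₂₁ nc Tz Tu)ᵀ))
        (fromCols (fromCols 0 1) 0)))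
    (fromRows
      (fromCols (fromCols (-(S.lfrB₂ Tz Q₂)ᵀ) (-(S.lfrD₁₂)ᵀ)) (-(S.lfrD₂ Tz Q₂ ρ)ᵀ))
      (fromCols (fromCols 0 0) 1))

/-- `(Y, Z, θ₁, θ₂)` is feasible for the robust synthesis LMI with multipliers `Θ₁, Θ₂`,
weight `ρ` and performance level `γ`. -/
def SynthesisLMI (Tz : Matrix (Fin r) (Fin q) ℝ) (Tu : Matrix (Fin m) (Fin q) ℝ)
    (Q₁ : Matrix (Fin m) (Fin m) ℝ) (Q₂ : Matrix (Fin r) (Fin r) ℝ)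
    (Θ₁ : Matrix (Fin m ⊕ Fin m) (Fin m ⊕ Fin m) ℝ)
    (Θ₂ : Matrix (Fin r ⊕ Fin r) (Fin r ⊕ Fin r) ℝ) (ρ γ : ℝ)
    (Y : Matrix (Fin q ⊕ Fin nc) (Fin q ⊕ Fin nc) ℝ) (Z : Matrix (Fin m) (Fin q ⊕ Fin nc) ℝ)
    (θ₁ θ₂ : ℝ) : Prop :=
  Y.PosDef ∧ 0 < θ₁ ∧ 0 < θ₂ ∧
    (-((S.lmiOuter Tz Tu Q₁ Q₂ ρ Y Z)ᵀ *
        lmiInner nw q nc γ (daug (θ₁⁻¹ • Θ₁) (θ₂⁻¹ • Θ₂)) *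
        S.lmiOuter Tz Tu Q₁ Q₂ ρ Y Z)).PosDef

end Data

end OSS

end

/-!
If the plant is replaced by its steady-state map, the controller becomes a vector field in `η`
alone. The synthesis inequality is the dual of a dissipation inequality for this reduced field:
exchanging the multiplier `Θ` with its inverse, which is possible because the upper left block of
`Θ` is negative semidefinite, turns it into strong dissipativity in the inner product `Y⁻¹`, the
nonlinearities being absorbed by their sector constraints. So the reduced field has at most one
zero.

For inputs that the nonlinearities do not see, dissipativity forces `η ↦ K η` to be injective, and
counting dimensions in the kernel spanned by `[Tz; Tu]` it is also surjective. The interior optimal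
point is therefore realized by some `η`, and its first-order condition says exactly that the reduced
field vanishes there.

Strong dissipativity makes this zero continuous in `w`, so over the compact set of signals the
gradients have one Lipschitz constant near all equilibria. A Lyapunov form of the Hurwitz matrix `A`
for the deviation of the plant from its steady state, plus `ηᵀ Y⁻¹ η`, then decreases exponentially
once the controller is slow enough, with a threshold that does not depend on `w`.
-/

noncomputable section

namespace OSS

/-! ### Dualization of quadratic matrix inequalities -/

section QuadraticForms

open scoped MatrixOrder Matrix.Norms.L2Operator

theorem exists_pos_mul_dotProduct_le {κ : Type*} [Fintype κ] {M : Matrix κ κ ℝ}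
    (hM : M.PosDef) : ∃ ε > 0, ∀ x : κ → ℝ, ε * (x ⬝ᵥ x) ≤ x ⬝ᵥ (M *ᵥ x) := by
  classical
  rcases isEmpty_or_nonempty κ with _ | _
  · exact ⟨1, one_pos, fun x ↦ by simp [dotProduct]⟩
  obtain ⟨ε, hε, hle⟩ := (CFC.exists_pos_algebraMap_le_iff hM.isHermitian).2
    fun _ hx ↦ hM.isStrictlyPositive.spectrum_pos hx
  refine ⟨ε, hε, fun x ↦ ?_⟩
  simpa [sub_mulVec, Algebra.algebraMap_eq_smul_one, smul_mulVec, dotProduct_sub]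
    using (Matrix.le_iff.1 hle).dotProduct_mulVec_nonneg x

end QuadraticForms

section Dualization

variable {κ ι : Type*} [Fintype κ] [Fintype ι]

theorem dotProduct_mulVec_comm {M : Matrix κ κ ℝ} (hM : M.IsSymm) (x y : κ → ℝ) :
    x ⬝ᵥ (M *ᵥ y) = y ⬝ᵥ (M *ᵥ x) := by
  rw [← dotProduct_transpose_mulVec, hM.eq]

theorem exists_mulVec_sumElim_eq {M : Matrix (κ ⊕ ι) (κ ⊕ ι) ℝ}
    (hM : ∀ b : ι → ℝ, b ≠ 0 → 0 < Sum.elim 0 b ⬝ᵥ (M *ᵥ Sum.elim 0 b)) (a : κ → ℝ)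
    (h : ι → ℝ) : ∃ b p, M *ᵥ Sum.elim a b = Sum.elim p h := by
  have hker : ∀ b, M.toBlocks₂₂ *ᵥ b = 0 → b = 0 := fun b hb ↦ by
    by_contra hb0
    have hpos := hM b hb0
    rw [← fromBlocks_toBlocks M, fromBlocks_mulVec] at hpos
    simp [hb] at hpos
  have hsurj : Function.Surjective M.toBlocks₂₂.mulVecLin :=
    LinearMap.injective_iff_surjective.1 (LinearMap.ker_eq_bot.1 (LinearMap.ker_eq_bot'.2 hker))
  obtain ⟨b, hb⟩ := hsurj (h - M.toBlocks₂₁ *ᵥ a)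
  refine ⟨b, M.toBlocks₁₁ *ᵥ a + M.toBlocks₁₂ *ᵥ b, ?_⟩
  rw [mulVecLin_apply] at hb
  conv_lhs => rw [← fromBlocks_toBlocks M, fromBlocks_mulVec]
  simp [hb]

theorem sumElim_dotProduct_mulVec_le {Θ : Matrix (κ ⊕ ι) (κ ⊕ ι) ℝ} (hsymm : Θ.IsSymm)
    (hΘ : ∀ d : κ → ℝ, Sum.elim d 0 ⬝ᵥ (Θ *ᵥ Sum.elim d 0) ≤ 0) (p p' : κ → ℝ) (h : ι → ℝ) :
    Sum.elim p h ⬝ᵥ (Θ *ᵥ Sum.elim p h) ≤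
      Sum.elim p' h ⬝ᵥ (Θ *ᵥ Sum.elim p' h) +
        2 * (Sum.elim (p - p') 0 ⬝ᵥ (Θ *ᵥ Sum.elim p' h)) := by
  have hsplit : Sum.elim p h = Sum.elim (p - p') 0 + Sum.elim p' h := by
    ext (i | i) <;> simp
  have hneg := hΘ (p - p')
  rw [hsplit, mulVec_add, add_dotProduct, dotProduct_add, dotProduct_add,
    dotProduct_mulVec_comm hsymm (Sum.elim p' h) (Sum.elim (p - p') 0)]
  linarith

variable [DecidableEq ι]

/- For given `ζ`, choose `b` such that `Θ⁻¹ (-Gᵀ ζ, b) = (p', H ζ)`. The dual inequality at `(ζ, b)`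
is then the primal one at `(ζ, p')`, and `p'` maximizes the primal form, which is concave in `p`. -/
theorem primal_le_of_dual_le (F : Matrix κ κ ℝ) (G : Matrix κ ι ℝ) (H : Matrix ι κ ℝ)
    {Θ : Matrix (ι ⊕ ι) (ι ⊕ ι) ℝ} (hsymm : Θ.IsSymm) (hdet : IsUnit Θ.det)
    (hΘ : ∀ d : ι → ℝ, Sum.elim d 0 ⬝ᵥ (Θ *ᵥ Sum.elim d 0) ≤ 0) {ε : ℝ} (hε : 0 < ε)
    (hdual : ∀ (a : κ → ℝ) (b : ι → ℝ),
      2 * (a ⬝ᵥ (F *ᵥ a)) + 2 * (b ⬝ᵥ (H *ᵥ a)) + ε * (a ⬝ᵥ a + b ⬝ᵥ b) ≤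
        Sum.elim (-(Gᵀ *ᵥ a)) b ⬝ᵥ (Θ⁻¹ *ᵥ Sum.elim (-(Gᵀ *ᵥ a)) b))
    (ζ : κ → ℝ) (p : ι → ℝ) :
    2 * (ζ ⬝ᵥ (F *ᵥ ζ + G *ᵥ p)) + Sum.elim p (H *ᵥ ζ) ⬝ᵥ (Θ *ᵥ Sum.elim p (H *ᵥ ζ)) ≤
      -ε * (ζ ⬝ᵥ ζ) := by
  have hpos : ∀ b : ι → ℝ, b ≠ 0 → 0 < Sum.elim 0 b ⬝ᵥ (Θ⁻¹ *ᵥ Sum.elim 0 b) := fun b hb ↦ by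
    have hbb : 0 < b ⬝ᵥ b := by simpa using dotProduct_star_self_pos_iff.2 hb
    have hle : ε * (b ⬝ᵥ b) ≤ Sum.elim 0 b ⬝ᵥ (Θ⁻¹ *ᵥ Sum.elim 0 b) := by simpa using hdual 0 b
    exact (mul_pos hε hbb).trans_le hle
  obtain ⟨b, p', hb⟩ := exists_mulVec_sumElim_eq hpos (-(Gᵀ *ᵥ ζ)) (H *ᵥ ζ)
  have hp' : Θ *ᵥ Sum.elim p' (H *ᵥ ζ) = Sum.elim (-(Gᵀ *ᵥ ζ)) b := by
    rw [← hb, mulVec_mulVec, mul_nonsing_inv _ hdet, one_mulVec]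
  have hconcave := sumElim_dotProduct_mulVec_le hsymm hΘ p p' (H *ᵥ ζ)
  have hζ := hdual ζ b
  have hbb : 0 ≤ ε * (b ⬝ᵥ b) := mul_nonneg hε.le (by simpa using dotProduct_star_self_nonneg b)
  rw [hp'] at hconcave
  rw [hb] at hζ
  simp only [sumElim_dotProduct_sumElim, dotProduct_comm _ p', dotProduct_comm _ b,
    dotProduct_neg, dotProduct_transpose_mulVec, mulVec_sub, dotProduct_sub, dotProduct_zero,
    dotProduct_add] at hconcave hζ ⊢
  linarith

end Dualization

section DiagonalAugmentation

variable {k l : ℕ} {Θ₁ : Matrix (Fin k ⊕ Fin k) (Fin k ⊕ Fin k) ℝ}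
  {Θ₂ : Matrix (Fin l ⊕ Fin l) (Fin l ⊕ Fin l) ℝ}

theorem daug_eq_submatrix :
    daug Θ₁ Θ₂ = (fromBlocks Θ₁ 0 0 Θ₂).submatrix (Equiv.sumSumSumComm _ _ _ _)
      (Equiv.sumSumSumComm _ _ _ _) := by
  ext ((i | i) | (i | i)) ((j | j) | (j | j)) <;> rfl

theorem daug_isSymm (h₁ : Θ₁.IsSymm) (h₂ : Θ₂.IsSymm) : (daug Θ₁ Θ₂).IsSymm := by
  rw [daug_eq_submatrix]
  exact (h₁.fromBlocks transpose_zero h₂).submatrix _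

theorem det_daug : (daug Θ₁ Θ₂).det = Θ₁.det * Θ₂.det := by
  rw [daug_eq_submatrix, det_submatrix_equiv_self, det_fromBlocks_zero₂₁]

theorem dotProduct_daug_mulVec (p₁ q₁ : Fin k → ℝ) (p₂ q₂ : Fin l → ℝ) :
    Sum.elim (Sum.elim p₁ p₂) (Sum.elim q₁ q₂) ⬝ᵥ
        (daug Θ₁ Θ₂ *ᵥ Sum.elim (Sum.elim p₁ p₂) (Sum.elim q₁ q₂)) =
      Sum.elim p₁ q₁ ⬝ᵥ (Θ₁ *ᵥ Sum.elim p₁ q₁) + Sum.elim p₂ q₂ ⬝ᵥ (Θ₂ *ᵥ Sum.elim p₂ q₂) := by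
  conv_rhs => rw [← fromBlocks_toBlocks Θ₁, ← fromBlocks_toBlocks Θ₂]
  simp only [daug, fromBlocks_mulVec, Sum.elim_comp_inl, Sum.elim_comp_inr,
    sumElim_dotProduct_sumElim, zero_mulVec, add_zero, zero_add, dotProduct_add]
  ring

end DiagonalAugmentation

namespace IsSectorMultiplier

variable {k : ℕ} {s : Set (EuclideanSpace ℝ (Fin k))}
  {Δ : EuclideanSpace ℝ (Fin k) → EuclideanSpace ℝ (Fin k)}
  {Θ : Matrix (Fin k ⊕ Fin k) (Fin k ⊕ Fin k) ℝ}

theorem smul (h : IsSectorMultiplier s Δ Θ) {c : ℝ} (hc : 0 < c) :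
    IsSectorMultiplier s Δ (c • Θ) where
  symm := h.symm.smul c
  nonsing := by
    rw [det_smul]
    exact (hc.ne'.isUnit.pow _).mul h.nonsing
  upperLeft := by
    have hblock : -(c • Θ).toBlocks₁₁ = c • -Θ.toBlocks₁₁ := (smul_neg c Θ.toBlocks₁₁).symm
    rw [hblock]
    exact h.upperLeft.smul hc.le
  sector v hv v' hv' := by
    rw [smul_mulVec, dotProduct_smul]
    exact smul_nonneg hc.le (h.sector v hv v' hv')

theorem sumElim_zero_dotProduct_nonpos (h : IsSectorMultiplier s Δ Θ) (d : Fin k → ℝ) :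
    Sum.elim d 0 ⬝ᵥ (Θ *ᵥ Sum.elim d 0) ≤ 0 := by
  rw [← fromBlocks_toBlocks Θ, fromBlocks_mulVec]
  simpa [neg_mulVec] using h.upperLeft.dotProduct_mulVec_nonneg d

end IsSectorMultiplier

namespace Data

variable {n m r nc nw q : ℕ} {S : Data n m r nc nw} {Tz : Matrix (Fin r) (Fin q) ℝ}
  {Tu : Matrix (Fin m) (Fin q) ℝ} {Q₁ : Matrix (Fin m) (Fin m) ℝ} {Q₂ : Matrix (Fin r) (Fin r) ℝ}
  {Θ₁ : Matrix (Fin m ⊕ Fin m) (Fin m ⊕ Fin m) ℝ} {Θ₂ : Matrix (Fin r ⊕ Fin r) (Fin r ⊕ Fin r) ℝ}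
  {ρ γ : ℝ} {Y : Matrix (Fin q ⊕ Fin nc) (Fin q ⊕ Fin nc) ℝ}
  {Z : Matrix (Fin m) (Fin q ⊕ Fin nc) ℝ} {θ₁ θ₂ : ℝ}

/- The performance channel `w ↦ E₂` only contributes the square of a norm, which is dropped. -/
theorem SynthesisLMI.exists_dual_le (h : S.SynthesisLMI Tz Tu Q₁ Q₂ Θ₁ Θ₂ ρ γ Y Z θ₁ θ₂) :
    ∃ ε > 0, ∀ (a : Fin q ⊕ Fin nc → ℝ) (b : Fin m ⊕ Fin r → ℝ),
      2 * (a ⬝ᵥ ((S.lfrB Tz Tu Q₁ Q₂ * Z) *ᵥ a)) + 2 * (b ⬝ᵥ ((S.lfrE₁ * Z) *ᵥ a)) +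
          ε * (a ⬝ᵥ a + b ⬝ᵥ b) ≤
        Sum.elim (-((lfrB₁ nc Tz Tu)ᵀ *ᵥ a)) b ⬝ᵥ
          ((daug (θ₁⁻¹ • Θ₁) (θ₂⁻¹ • Θ₂))⁻¹ *ᵥ Sum.elim (-((lfrB₁ nc Tz Tu)ᵀ *ᵥ a)) b) := by
  obtain ⟨ε, hε, hlmi⟩ := exists_pos_mul_dotProduct_le h.2.2.2
  refine ⟨ε, hε, fun a b ↦ ?_⟩
  have hab := hlmi (Sum.elim (Sum.elim a b) 0)
  rw [neg_mulVec, dotProduct_neg, ← mulVec_mulVec, ← mulVec_mulVec, dotProduct_mulVec _ _ᵀ,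
    vecMul_transpose] at hab
  simp only [lmiOuter, lmiInner, fromRows_mulVec, fromCols_mulVec, Sum.elim_comp_inl,
    Sum.elim_comp_inr, fromBlocks_mulVec, sumElim_dotProduct_sumElim, zero_mulVec, mulVec_zero,
    add_zero, zero_add, one_mulVec, neg_mulVec, dotProduct_neg, lfrA, lfrC₁, zero_mul,
    Matrix.zero_mul, lfrD₁, transpose_zero, neg_zero, dotProduct_zero] at hab
  set v := -((S.lfrB₂ Tz Q₂)ᵀ *ᵥ a) + -(S.lfrD₁₂ᵀ *ᵥ b)
  have hv : 0 ≤ v ⬝ᵥ v := by simpa using dotProduct_star_self_nonneg v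
  rw [dotProduct_comm (_ + _) a] at hab
  simp only [dotProduct_add, dotProduct_neg, dotProduct_transpose_mulVec] at hab
  linarith

theorem SynthesisLMI.exists_primal_le {s₁ : Set (EuclideanSpace ℝ (Fin m))}
    {s₂ : Set (EuclideanSpace ℝ (Fin r))} {Δ₁ : EuclideanSpace ℝ (Fin m) → _}
    {Δ₂ : EuclideanSpace ℝ (Fin r) → _} (h : S.SynthesisLMI Tz Tu Q₁ Q₂ Θ₁ Θ₂ ρ γ Y Z θ₁ θ₂)
    (h₁ : IsSectorMultiplier s₁ Δ₁ Θ₁) (h₂ : IsSectorMultiplier s₂ Δ₂ Θ₂) :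
    ∃ ε > 0, ∀ (ζ : Fin q ⊕ Fin nc → ℝ) (p : Fin m ⊕ Fin r → ℝ),
      2 * (ζ ⬝ᵥ ((S.lfrB Tz Tu Q₁ Q₂ * Z) *ᵥ ζ + lfrB₁ nc Tz Tu *ᵥ p)) +
        Sum.elim p ((S.lfrE₁ * Z) *ᵥ ζ) ⬝ᵥ
          (daug (θ₁⁻¹ • Θ₁) (θ₂⁻¹ • Θ₂) *ᵥ Sum.elim p ((S.lfrE₁ * Z) *ᵥ ζ)) ≤
      -ε * (ζ ⬝ᵥ ζ) := by
  obtain ⟨ε, hε, hdual⟩ := h.exists_dual_le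
  replace h₁ := h₁.smul (inv_pos.2 h.2.1)
  replace h₂ := h₂.smul (inv_pos.2 h.2.2.1)
  refine ⟨ε, hε, primal_le_of_dual_le _ _ _ (daug_isSymm h₁.symm h₂.symm) ?_ (fun d ↦ ?_) hε hdual⟩
  · rw [det_daug]
    exact h₁.nonsing.mul h₂.nonsing
  · have hd := dotProduct_daug_mulVec (Θ₁ := θ₁⁻¹ • Θ₁) (Θ₂ := θ₂⁻¹ • Θ₂)
      (d ∘ Sum.inl) 0 (d ∘ Sum.inr) 0
    rw [Sum.elim_comp_inl_inr, Sum.elim_zero_zero] at hd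
    rw [hd]
    exact add_nonpos (h₁.sumElim_zero_dotProduct_nonpos _) (h₂.sumElim_zero_dotProduct_nonpos _)

end Data

/-! ### Lyapunov functions of Hurwitz matrices -/

section Lyapunov

open Filter Topology
open scoped Matrix.Norms.L2Operator

theorem tendsto_pow_zero_of_forall_mem_spectrum {𝒜 : Type*} [NormedRing 𝒜] [NormedAlgebra ℂ 𝒜]
    [CompleteSpace 𝒜] {a : 𝒜} (ha : ∀ μ ∈ spectrum ℂ a, ‖μ‖ < 1) :
    Tendsto (fun k : ℕ ↦ a ^ k) atTop (𝓝 0) := by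
  rcases subsingleton_or_nontrivial 𝒜 with _ | _
  · exact tendsto_const_nhds.congr fun _ ↦ Subsingleton.elim _ _
  have hr : spectralRadius ℂ a < ((1 : NNReal) : ENNReal) :=
    spectrum.spectralRadius_lt_of_forall_lt a fun μ hμ ↦ by exact_mod_cast ha μ hμ
  obtain ⟨c, hrc, hc⟩ := ENNReal.lt_iff_exists_nnreal_btwn.1 hr
  refine squeeze_zero_norm' ?_ (tendsto_pow_atTop_nhds_zero_of_lt_one c.2 (by exact_mod_cast hc))
  have hlim := spectrum.pow_nnnorm_pow_one_div_tendsto_nhds_spectralRadius a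
  filter_upwards [hlim.eventually_lt_const hrc, eventually_gt_atTop 0] with k hk hk0
  have hpow := ENNReal.rpow_le_rpow hk.le (Nat.cast_nonneg k : (0 : ℝ) ≤ k)
  rw [← ENNReal.rpow_mul, one_div, inv_mul_cancel₀ (by positivity), ENNReal.rpow_one,
    ENNReal.rpow_natCast] at hpow
  exact_mod_cast hpow

theorem tendsto_matrix_pow_zero {κ : Type*} [Fintype κ] [DecidableEq κ] {M : Matrix κ κ ℝ}
    (hM : ∀ μ ∈ spectrum ℂ (M.map (algebraMap ℝ ℂ)), ‖μ‖ < 1) :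
    Tendsto (fun k : ℕ ↦ M ^ k) atTop (𝓝 0) := by
  have hre := (continuous_id.matrix_map Complex.continuous_re).tendsto (0 : Matrix κ κ ℂ)
  refine ((hre.comp (tendsto_pow_zero_of_forall_mem_spectrum hM)).congr fun k ↦ ?_).trans_eq ?_
  · have hmap : M.map (algebraMap ℝ ℂ) ^ k = (M ^ k).map (algebraMap ℝ ℂ) :=
      (map_pow (algebraMap ℝ ℂ).mapMatrix M k).symm
    ext i j
    change ((M.map (algebraMap ℝ ℂ) ^ k) i j).re = (M ^ k) i j
    rw [hmap, map_apply, Complex.coe_algebraMap, Complex.ofReal_re]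
  · simp

theorem norm_lt_one_of_mem_spectrum_cayley {𝒜 : Type*} [Ring 𝒜] [Algebra ℂ 𝒜] {a b : 𝒜}
    (hab : (1 - a) * b = 1) (hba : b * (1 - a) = 1) (ha : ∀ s ∈ spectrum ℂ a, s.re < 0) {μ : ℂ}
    (hμ : μ ∈ spectrum ℂ ((1 + a) * b)) : ‖μ‖ < 1 := by
  have hfactor : algebraMap ℂ 𝒜 μ - (1 + a) * b =
      (algebraMap ℂ 𝒜 (μ - 1) - (μ + 1) • a) * b := by
    have hμb : algebraMap ℂ 𝒜 μ = (μ • (1 - a)) * b := by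
      rw [smul_mul_assoc, hab, Algebra.algebraMap_eq_smul_one]
    rw [hμb, ← sub_mul, Algebra.algebraMap_eq_smul_one]
    congr 1
    module
  have hb : IsUnit b := ⟨⟨b, 1 - a, hba, hab⟩, rfl⟩
  rw [spectrum.mem_iff, hfactor, hb.mul_right_iff] at hμ
  have hμ1 : μ + 1 ≠ 0 := fun h0 ↦ hμ <| by
    rw [h0, zero_smul, sub_zero, eq_neg_of_add_eq_zero_left h0]
    exact (isUnit_iff_ne_zero.2 (by norm_num)).map (algebraMap ℂ 𝒜)
  have hmem : (μ - 1) / (μ + 1) ∈ spectrum ℂ a := fun hu ↦ hμ <| by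
    have hunit := ((isUnit_iff_ne_zero.2 hμ1).map (algebraMap ℂ 𝒜)).mul hu
    rwa [mul_sub, ← map_mul, mul_div_cancel₀ _ hμ1, ← Algebra.smul_def] at hunit
  have hre := ha _ hmem
  rw [Complex.div_re, ← add_div, div_lt_iff₀ (Complex.normSq_pos.2 hμ1), zero_mul] at hre
  simp only [Complex.sub_re, Complex.add_re, Complex.one_re, Complex.sub_im, Complex.add_im,
    Complex.one_im] at hre
  have hsq : ‖μ‖ ^ 2 < 1 := by
    rw [← Complex.normSq_eq_norm_sq, Complex.normSq_apply]
    linarith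
  exact (sq_lt_one_iff₀ (norm_nonneg _)).1 hsq

theorem ofLp_dotProduct_ofLp_self {κ : Type*} [Fintype κ] (x : EuclideanSpace ℝ κ) :
    x.ofLp ⬝ᵥ x.ofLp = ‖x‖ ^ 2 := by
  rw [EuclideanSpace.real_norm_sq_eq]
  simp only [dotProduct, sq]

theorem exists_posDef_stein {κ : Type*} [Fintype κ] [DecidableEq κ] {M : Matrix κ κ ℝ}
    (hM : ∀ μ ∈ spectrum ℂ (M.map (algebraMap ℝ ℂ)), ‖μ‖ < 1) :
    ∃ P : Matrix κ κ ℝ, P.PosDef ∧ ∀ v : κ → ℝ,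
      (M *ᵥ v) ⬝ᵥ (P *ᵥ (M *ᵥ v)) ≤ v ⬝ᵥ (P *ᵥ v) - 1 / 2 * (v ⬝ᵥ v) := by
  have hdot : ∀ v : κ → ℝ, v ⬝ᵥ v = ‖WithLp.toLp 2 v‖ ^ 2 := fun v ↦ ofLp_dotProduct_ofLp_self _
  have hnorm : Tendsto (fun k : ℕ ↦ ‖M ^ (k + 1)‖) atTop (𝓝 0) := by
    simpa using ((tendsto_matrix_pow_zero hM).comp (tendsto_add_atTop_nat 1)).norm
  obtain ⟨k, hk⟩ := (hnorm.eventually_le_const (by norm_num : (0 : ℝ) < 1 / 2)).exists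
  refine ⟨∑ j ∈ Finset.range (k + 1), (M ^ j)ᴴ * M ^ j, ?_, fun v ↦ ?_⟩
  · rw [Finset.sum_range_succ']
    refine PosDef.posSemidef_add (posSemidef_sum _ fun j _ ↦ posSemidef_conjTranspose_mul_self _) ?_
    simpa using PosDef.one
  have hform : ∀ x : κ → ℝ, x ⬝ᵥ ((∑ j ∈ Finset.range (k + 1), (M ^ j)ᴴ * M ^ j) *ᵥ x) =
      ∑ j ∈ Finset.range (k + 1), (M ^ j *ᵥ x) ⬝ᵥ (M ^ j *ᵥ x) := fun x ↦ by
    simp only [sum_mulVec, dotProduct_sum, conjTranspose_eq_transpose_of_trivial,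
      ← mulVec_mulVec, dotProduct_transpose_mulVec]
  have htelescope := Finset.sum_range_sub (fun j ↦ (M ^ j *ᵥ v) ⬝ᵥ (M ^ j *ᵥ v)) (k + 1)
  simp only [Finset.sum_sub_distrib, pow_zero, one_mulVec] at htelescope
  have hcontract : ‖WithLp.toLp 2 (M ^ (k + 1) *ᵥ v)‖ ≤ 1 / 2 * ‖WithLp.toLp 2 v‖ :=
    (l2_opNorm_mulVec (M ^ (k + 1)) (WithLp.toLp 2 v)).trans (by gcongr)
  rw [hform, hform]
  simp only [mulVec_mulVec, ← pow_succ]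
  rw [hdot (M ^ (k + 1) *ᵥ v)] at htelescope
  rw [hdot v] at htelescope ⊢
  nlinarith [norm_nonneg (WithLp.toLp 2 (M ^ (k + 1) *ᵥ v))]

theorem IsHurwitz.isUnit_algebraMap_sub {n : ℕ} {A : Matrix (Fin n) (Fin n) ℝ} (hA : IsHurwitz A)
    {t : ℝ} (ht : 0 ≤ t) : IsUnit (algebraMap ℝ _ t - A) := by
  have hmem : (t : ℂ) ∉ spectrum ℂ (A.map (algebraMap ℝ ℂ)) := fun h ↦ (hA _ h).not_ge ht
  have hmap : algebraMap ℂ (Matrix (Fin n) (Fin n) ℂ) t - A.map (algebraMap ℝ ℂ) =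
      (algebraMap ℝ ℂ).mapMatrix (algebraMap ℝ _ t - A) := by
    ext i j
    simp [algebraMap_matrix_apply, apply_ite]
  rw [spectrum.notMem_iff, hmap, isUnit_iff_isUnit_det, ← RingHom.map_det, isUnit_map_iff] at hmem
  exact (isUnit_iff_isUnit_det _).2 hmem

theorem IsHurwitz.isUnit_det {n : ℕ} {A : Matrix (Fin n) (Fin n) ℝ} (hA : IsHurwitz A) :
    IsUnit A.det := by
  rw [← isUnit_iff_isUnit_det, ← IsUnit.neg_iff]
  simpa using hA.isUnit_algebraMap_sub le_rfl

/- The Cayley transform `M = (1 + A) (1 - A)⁻¹` maps the left half plane to the unit disc, and a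
solution of the Stein inequality for `M` solves the Lyapunov inequality for `A`. -/
theorem IsHurwitz.exists_lyapunov {n : ℕ} {A : Matrix (Fin n) (Fin n) ℝ} (hA : IsHurwitz A) :
    ∃ P : Matrix (Fin n) (Fin n) ℝ, P.PosDef ∧ ∃ α > 0, ∀ y : Fin n → ℝ,
      y ⬝ᵥ (P *ᵥ (A *ᵥ y)) ≤ -α * (y ⬝ᵥ y) := by
  have hunit : IsUnit (1 - A) := by simpa using hA.isUnit_algebraMap_sub zero_le_one
  obtain ⟨b, hab, hba⟩ := isUnit_iff_exists.1 hunit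
  have hspec : ∀ μ ∈ spectrum ℂ (((1 + A) * b).map (algebraMap ℝ ℂ)), ‖μ‖ < 1 := fun μ hμ ↦ by
    let φ := (algebraMap ℝ ℂ).mapMatrix (m := Fin n)
    have hφ : φ ((1 + A) * b) = (1 + φ A) * φ b := by rw [map_mul, map_add, map_one]
    change μ ∈ spectrum ℂ (φ ((1 + A) * b)) at hμ
    rw [hφ] at hμ
    refine norm_lt_one_of_mem_spectrum_cayley ?_ ?_ hA hμ
    · change (1 - φ A) * φ b = 1
      rw [← map_one φ, ← map_sub, ← map_mul, hab]
    · change φ b * (1 - φ A) = 1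
      rw [← map_one φ, ← map_sub, ← map_mul, hba]
  obtain ⟨P, hP, hstein⟩ := exists_posDef_stein hspec
  obtain ⟨ε, hε, hlower⟩ := exists_pos_mul_dotProduct_le
    (PosDef.conjTranspose_mul_self (1 - A) (mulVec_injective_of_isUnit hunit))
  refine ⟨P, hP, ε / 8, by positivity, fun y ↦ ?_⟩
  have hPsymm := dotProduct_mulVec_comm (M := P) hP.isHermitian (A *ᵥ y) y
  have hy := hlower y
  have hv := hstein ((1 - A) *ᵥ y)
  rw [conjTranspose_eq_transpose_of_trivial, ← mulVec_mulVec, dotProduct_transpose_mulVec] at hy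
  have hcayley : ((1 + A) * b) *ᵥ ((1 - A) *ᵥ y) = (1 + A) *ᵥ y := by
    rw [mulVec_mulVec, Matrix.mul_assoc, hba, Matrix.mul_one]
  rw [hcayley] at hv
  have hpolar : ((1 + A) *ᵥ y) ⬝ᵥ (P *ᵥ ((1 + A) *ᵥ y)) -
      ((1 - A) *ᵥ y) ⬝ᵥ (P *ᵥ ((1 - A) *ᵥ y)) = 4 * (y ⬝ᵥ (P *ᵥ (A *ᵥ y))) := by
    simp only [add_mulVec, sub_mulVec, one_mulVec, mulVec_add, mulVec_sub, add_dotProduct,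
      sub_dotProduct, dotProduct_add, dotProduct_sub, hPsymm]
    ring
  linarith

end Lyapunov

/-! ### Exponential stability from quadratic Lyapunov functions -/

section ODE

open Filter Topology

variable {E : Type*} [NormedAddCommGroup E] [NormedSpace ℝ E]

theorem exists_hasDerivWithinAt_Icc [CompleteSpace E] {G : E → E} {K C : NNReal}
    (hG : LipschitzWith K G) (hC : ∀ x, ‖G x‖ ≤ C) (x₀ : E) (T : NNReal) :
    ∃ x : ℝ → E, x 0 = x₀ ∧
      ∀ t ∈ Icc (0 : ℝ) T, HasDerivWithinAt x (G (x t)) (Icc (0 : ℝ) T) t := by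
  have hpl : IsPicardLindelof (fun _ ↦ G) (tmin := 0) (tmax := (T : ℝ))
      ⟨0, left_mem_Icc.2 T.2⟩ x₀ (C * T) 0 C K :=
    { lipschitzOnWith := fun _ _ ↦ hG.lipschitzOnWith
      continuousOn := fun _ _ ↦ continuousOn_const
      norm_le := fun _ _ x _ ↦ hC x
      mul_max_le := by simp }
  exact hpl.exists_eq_forall_mem_Icc_hasDerivWithinAt₀

theorem eqOn_of_hasDerivWithinAt_Icc {G : E → E} {K : NNReal} (hG : LipschitzWith K G)
    {x y : ℝ → E} (h₀ : x 0 = y 0) {T : ℝ}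
    (hx : ∀ t ∈ Icc 0 T, HasDerivWithinAt x (G (x t)) (Icc 0 T) t)
    (hy : ∀ t ∈ Icc 0 T, HasDerivWithinAt y (G (y t)) (Icc 0 T) t) : EqOn x y (Icc 0 T) := by
  have hright : ∀ {z : ℝ → E}, (∀ t ∈ Icc 0 T, HasDerivWithinAt z (G (z t)) (Icc 0 T) t) →
      ∀ t ∈ Ico 0 T, HasDerivWithinAt z (G (z t)) (Ici t) t := fun hz t ht ↦
    (hz t (Ico_subset_Icc_self ht)).mono_of_mem_nhdsWithin
      (mem_of_superset (Icc_mem_nhdsGE ht.2) (Icc_subset_Icc_left ht.1))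
  exact ODE_solution_unique (v := fun _ ↦ G) (fun _ ↦ hG)
    (fun t ht ↦ (hx t ht).continuousWithinAt) (hright hx)
    (fun t ht ↦ (hy t ht).continuousWithinAt) (hright hy) h₀

theorem exists_hasDerivWithinAt_Ici [CompleteSpace E] {G : E → E} {K C : NNReal}
    (hG : LipschitzWith K G) (hC : ∀ x, ‖G x‖ ≤ C) (x₀ : E) :
    ∃ x : ℝ → E, x 0 = x₀ ∧ ∀ t, 0 ≤ t → HasDerivWithinAt x (G (x t)) (Ici 0) t := by
  choose α hα₀ hα using fun k : ℕ ↦ exists_hasDerivWithinAt_Icc hG hC x₀ (k : NNReal)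
  simp only [NNReal.coe_natCast] at hα
  have hagree : ∀ i j : ℕ, i ≤ j → EqOn (α i) (α j) (Icc 0 i) := fun i j hij ↦ by
    have hsub : Icc (0 : ℝ) i ⊆ Icc 0 j := Icc_subset_Icc_right (by exact_mod_cast hij)
    exact eqOn_of_hasDerivWithinAt_Icc hG ((hα₀ i).trans (hα₀ j).symm) (hα i)
      fun t ht ↦ (hα j t (hsub ht)).mono hsub
  refine ⟨fun t ↦ α ⌈t⌉₊ t, by simpa using hα₀ 0, fun t ht ↦ ?_⟩
  have htN : t < (⌈t⌉₊ + 1 : ℕ) := by push_cast; linarith [Nat.le_ceil t]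
  have hglue : EqOn (fun s ↦ α ⌈s⌉₊ s) (α (⌈t⌉₊ + 1)) (Icc 0 (⌈t⌉₊ + 1 : ℕ)) := fun s hs ↦
    hagree _ _ (Nat.ceil_le.2 hs.2) ⟨hs.1, Nat.le_ceil s⟩
  have hderiv := (hα (⌈t⌉₊ + 1) t ⟨ht, htN.le⟩).congr hglue (hglue ⟨ht, htN.le⟩)
  rw [← hglue ⟨ht, htN.le⟩] at hderiv
  exact hderiv.mono_of_mem_nhdsWithin
    (inter_mem self_mem_nhdsWithin (mem_nhdsWithin_of_mem_nhds (Iic_mem_nhds htN)))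

theorem exists_bounded_lipschitz_extension [FiniteDimensional ℝ E] {X : Type*}
    [PseudoMetricSpace X] {f : X → E} {s : Set X} {K : NNReal} (hf : LipschitzOnWith K f s)
    (hbdd : Bornology.IsBounded (f '' s)) :
    ∃ (g : X → E) (K' C : NNReal), LipschitzWith K' g ∧ (∀ x, ‖g x‖ ≤ C) ∧ EqOn f g s := by
  let e := (Module.finBasis ℝ E).equivFunL
  obtain ⟨g, hg, hfg⟩ := (e.lipschitz.comp_lipschitzOnWith hf).extend_pi
  obtain ⟨a, ha, hbound⟩ := (e.lipschitz.isBounded_image hbdd).exists_pos_norm_le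
  have haa : -a ≤ a := by linarith
  let clip : (Fin (Module.finrank ℝ E) → ℝ) → Fin (Module.finrank ℝ E) → ℝ :=
    fun y i ↦ projIcc (-a) a haa (y i)
  have hclip : LipschitzWith 1 clip := LipschitzWith.of_dist_le_mul fun x y ↦ by
    rw [NNReal.coe_one, one_mul, dist_pi_le_iff dist_nonneg]
    refine fun i ↦ ((LipschitzWith.projIcc haa).dist_le_mul _ _).trans ?_
    rw [NNReal.coe_one, one_mul]
    exact dist_le_pi_dist x y i
  have hclip_norm : ∀ y, ‖clip y‖ ≤ a := fun y ↦
    (pi_norm_le_iff_of_nonneg ha.le).2 fun i ↦ abs_le.2 (projIcc (-a) a haa (y i)).2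
  have hclip_eq : ∀ y, ‖y‖ ≤ a → clip y = y := fun y hy ↦ funext fun i ↦ by
    simp only [clip, projIcc_of_mem haa (abs_le.1 ((norm_le_pi_norm y i).trans hy))]
  refine ⟨fun x ↦ e.symm (clip (g x)), _,
    ‖(e.symm : (Fin (Module.finrank ℝ E) → ℝ) →L[ℝ] E)‖₊ * a.toNNReal,
    e.symm.lipschitz.comp (hclip.comp hg), fun x ↦ ?_, fun x hx ↦ ?_⟩
  · rw [NNReal.coe_mul, Real.coe_toNNReal a ha.le]
    exact ((e.symm : (Fin (Module.finrank ℝ E) → ℝ) →L[ℝ] E).le_opNorm _).trans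
      (mul_le_mul_of_nonneg_left (hclip_norm _) (norm_nonneg _))
  · have hgx : g x = e (f x) := (hfg hx).symm
    have hfx : ‖e (f x)‖ ≤ a := hbound _ (mem_image_of_mem e (mem_image_of_mem f hx))
    simp only [hgx, hclip_eq _ hfx, ContinuousLinearEquiv.symm_apply_apply]

theorem le_mul_exp_of_deriv_lt {V V' : ℝ → ℝ} {μ b : ℝ} (hμ : 0 ≤ μ)
    (hV : ∀ t, 0 ≤ t → HasDerivWithinAt V (V' t) (Ici 0) t)
    (hdecay : ∀ t, 0 ≤ t → 0 < V t → V t < b → V' t < -μ * V t) (hV₀ : 0 ≤ V 0) (hb : V 0 < b)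
    {t : ℝ} (ht : 0 ≤ t) : V t ≤ V 0 * Real.exp (-μ * t) := by
  have hstrict : ∀ v ∈ Ioo (V 0) b, V t ≤ v * Real.exp (-μ * t) := fun v hv ↦ by
    have hexp : ∀ s, HasDerivAt (fun s ↦ v * Real.exp (-μ * s)) (v * (Real.exp (-μ * s) * -μ)) s :=
      fun s ↦ (((hasDerivAt_id s).const_mul (-μ)).exp.const_mul v).congr_deriv (by simp)
    refine image_le_of_deriv_right_lt_deriv_boundary
      (fun s hs ↦ (hV s hs.1).continuousWithinAt.mono Icc_subset_Ici_self)
      (fun s hs ↦ (hV s hs.1).mono (Ici_subset_Ici.2 hs.1)) (by simpa using hv.1.le) hexp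
      (fun s hs htouch ↦ ?_) (right_mem_Icc.2 ht)
    have hv₀ : 0 < v := hV₀.trans_lt hv.1
    have hle : Real.exp (-μ * s) ≤ 1 := Real.exp_le_one_iff.2 (by nlinarith [hs.1])
    have hlt := hdecay s hs.1 (htouch ▸ by positivity)
      (htouch ▸ (mul_le_of_le_one_right hv₀.le hle).trans_lt hv.2)
    rw [htouch] at hlt
    linarith
  refine ge_of_tendsto (((continuous_id.mul continuous_const).tendsto (V 0)).mono_left
    (nhdsWithin_le_nhds (s := Ioi (V 0)))) ?_
  filter_upwards [Ioo_mem_nhdsGT hb] with v hv using hstrict v hv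

section Lyapunov

variable {B : E →L[ℝ] E →L[ℝ] ℝ}

theorem bilin_self_le (B : E →L[ℝ] E →L[ℝ] ℝ) (v : E) : B v v ≤ ‖B‖ * ‖v‖ ^ 2 := by
  rw [sq, ← mul_assoc]
  exact (le_abs_self _).trans (B.le_opNorm₂ v v)

theorem hasDerivWithinAt_bilin_self (hsymm : ∀ x y, B x y = B y x) {x : ℝ → E} {x' : E}
    {s : Set ℝ} {t : ℝ} (hx : HasDerivWithinAt x x' s t) :
    HasDerivWithinAt (fun t ↦ B (x t) (x t)) (2 * B (x t) x') s t := by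
  refine ((B.hasFDerivAt.comp_hasDerivWithinAt t hx).clm_apply hx).congr_deriv ?_
  rw [hsymm x', Function.comp_apply, two_mul]

theorem bilin_sub_le_mul_exp (hsymm : ∀ x y, B x y = B y x) (hnonneg : ∀ v, 0 ≤ B v v) {G : E → E}
    {p : E} {b lam : ℝ} (hlam : 0 < lam)
    (hdec : ∀ y, B (y - p) (y - p) < b → B (y - p) (G y) ≤ -lam * ‖y - p‖ ^ 2) {x : ℝ → E}
    (hx : ∀ t, 0 ≤ t → HasDerivWithinAt x (G (x t)) (Ici 0) t)
    (h₀ : B (x 0 - p) (x 0 - p) < b) {t : ℝ} (ht : 0 ≤ t) :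
    B (x t - p) (x t - p) ≤
      B (x 0 - p) (x 0 - p) * Real.exp (-(lam / (‖B‖ + 1)) * t) := by
  refine le_mul_exp_of_deriv_lt (V := fun t ↦ B (x t - p) (x t - p)) (by positivity)
    (fun s hs ↦ hasDerivWithinAt_bilin_self hsymm ((hx s hs).sub_const p))
    (fun s _ hpos hlt ↦ ?_) (hnonneg _) h₀ ht
  have hupper := bilin_self_le B (x s - p)
  have hnorm : 0 < ‖x s - p‖ ^ 2 := by
    refine (sq_nonneg _).lt_of_ne fun h ↦ ?_
    rw [← h, mul_zero] at hupper
    exact hpos.not_ge hupper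
  have hrate : lam / (‖B‖ + 1) * B (x s - p) (x s - p) ≤ lam * ‖x s - p‖ ^ 2 := by
    rw [div_mul_eq_mul_div, div_le_iff₀ (by positivity)]
    nlinarith
  nlinarith [hdec _ hlt]

theorem norm_le_of_bilin_self_lt {c : ℝ} (hc : 0 < c) (hpos : ∀ v, c * ‖v‖ ^ 2 ≤ B v v) {R : ℝ}
    (hR : 0 ≤ R) {v : E} (hv : B v v < c * R ^ 2) : ‖v‖ ≤ R :=
  (abs_le_of_sq_le_sq' (le_of_mul_le_mul_left ((hpos v).trans hv.le) hc) hR).2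

theorem norm_le_sqrt_mul_exp {c b μ t : ℝ} (hc : 0 < c) (hpos : ∀ v, c * ‖v‖ ^ 2 ≤ B v v)
    (hb : ‖B‖ ≤ b) {v v₀ : E} (h : B v v ≤ B v₀ v₀ * Real.exp (-μ * t)) :
    ‖v‖ ≤ √(b / c) * Real.exp (-(μ / 2) * t) * ‖v₀‖ := by
  have hb₀ : 0 ≤ b := (norm_nonneg B).trans hb
  have hexp : Real.exp (-(μ / 2) * t) ^ 2 = Real.exp (-μ * t) := by
    rw [← Real.exp_nat_mul]
    ring_nf
  refine (abs_le_of_sq_le_sq' ?_ (by positivity)).2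
  rw [mul_pow, mul_pow, Real.sq_sqrt (by positivity), hexp]
  calc ‖v‖ ^ 2 ≤ B v v / c := (le_div_iff₀' hc).2 (hpos v)
    _ ≤ b * ‖v₀‖ ^ 2 * Real.exp (-μ * t) / c := by
      have := (bilin_self_le B v₀).trans (mul_le_mul_of_nonneg_right hb (sq_nonneg _))
      gcongr
      exact h.trans (by gcongr)
    _ = b / c * Real.exp (-μ * t) * ‖v₀‖ ^ 2 := by ring

/- Solutions are produced for a globally Lipschitz bounded extension of the vector field; since they
cannot leave a sublevel set of the Lyapunov function, they solve the original equation. -/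
theorem isLocallyExpStable_of_lyapunov [FiniteDimensional ℝ E] {F : E → E} {dom U : Set E} {p : E}
    (hsymm : ∀ x y, B x y = B y x) {c : ℝ} (hc : 0 < c) (hpos : ∀ v, c * ‖v‖ ^ 2 ≤ B v v)
    (hU : U ∈ 𝓝 p) (hdom : U ⊆ dom) {K : NNReal} (hF : LipschitzOnWith K F U) {lam : ℝ}
    (hlam : 0 < lam) (hdec : ∀ x ∈ U, B (x - p) (F x) ≤ -lam * ‖x - p‖ ^ 2) :
    IsLocallyExpStable F dom p := by
  have : ProperSpace E := FiniteDimensional.proper ℝ E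
  have hnonneg : ∀ v, 0 ≤ B v v := fun v ↦ le_trans (by positivity) (hpos v)
  obtain ⟨R, hR, hball⟩ := Metric.nhds_basis_closedBall.mem_iff.1 hU
  have hFR := hF.mono hball
  obtain ⟨G, K', C, hG, hC, hFG⟩ :=
    exists_bounded_lipschitz_extension hFR
      ((isCompact_closedBall p R).image_of_continuousOn hFR.continuousOn).isBounded
  have hsublevel : ∀ y, B (y - p) (y - p) < c * R ^ 2 → y ∈ Metric.closedBall p R := fun y hy ↦
    mem_closedBall_iff_norm.2 (norm_le_of_bilin_self_lt hc hpos hR.le hy)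
  have hdecF : ∀ y, B (y - p) (y - p) < c * R ^ 2 → B (y - p) (F y) ≤ -lam * ‖y - p‖ ^ 2 :=
    fun y hy ↦ hdec y (hball (hsublevel y hy))
  have hdecG : ∀ y, B (y - p) (y - p) < c * R ^ 2 → B (y - p) (G y) ≤ -lam * ‖y - p‖ ^ 2 :=
    fun y hy ↦ hFG (hsublevel y hy) ▸ hdecF y hy
  have hstart : ∀ᶠ x₀ in 𝓝 p, B (x₀ - p) (x₀ - p) < c * R ^ 2 := by
    have hcont : Continuous fun x ↦ B (x - p) (x - p) := by fun_prop
    exact hcont.continuousAt.eventually_lt_const (by simpa using by positivity)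
  obtain ⟨δ, hδ, hstart⟩ := Metric.eventually_nhds_iff.1 hstart
  refine ⟨√((‖B‖ + 1) / c), by positivity, lam / (‖B‖ + 1) / 2, by positivity, δ, hδ,
    fun x₀ hx₀ ↦ ⟨?_, ?_⟩⟩
  · obtain ⟨x, rfl, hx⟩ := exists_hasDerivWithinAt_Ici hG hC x₀
    have hV₀ := hstart ((dist_eq_norm _ _).trans_lt hx₀)
    have hmem : ∀ t, 0 ≤ t → x t ∈ Metric.closedBall p R := fun t ht ↦ by
      have hexp : Real.exp (-(lam / (‖B‖ + 1)) * t) ≤ 1 := Real.exp_le_one_iff.2 <| by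
        rw [neg_mul, neg_nonpos]
        positivity
      exact hsublevel _ (((bilin_sub_le_mul_exp hsymm hnonneg hlam hdecG hx hV₀ ht).trans
        (mul_le_of_le_one_right (hnonneg _) hexp)).trans_lt hV₀)
    exact ⟨x, fun t ht ↦ ⟨hdom (hball (hmem t ht)), hFG (hmem t ht) ▸ hx t ht⟩, rfl⟩
  · rintro x hx rfl t ht
    exact norm_le_sqrt_mul_exp hc hpos (by linarith) (bilin_sub_le_mul_exp hsymm hnonneg hlam hdecF
      (fun t ht ↦ (hx t ht).2) (hstart ((dist_eq_norm _ _).trans_lt hx₀)) ht)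

end Lyapunov

end ODE

/-! ### Two-time-scale systems with dissipative slow dynamics -/

section Dissipative

open Filter Topology

variable {E : Type*} [NormedAddCommGroup E] [NormedSpace ℝ E]

/-- Strong dissipativity with rate `ε` of the vector field `F` on `s`, in the geometry of the
bilinear form `B`: the negative of strong monotonicity. It makes zeros unique and Lipschitz in the
data, and `v ↦ B v v` a Lyapunov function. -/
def IsStronglyDissipativeOn (B : E →L[ℝ] E →L[ℝ] ℝ) (ε : ℝ) (F : E → E) (s : Set E) : Prop :=
  ∀ η ∈ s, ∀ η' ∈ s, B (η - η') (F η - F η') ≤ -ε * ‖η - η'‖ ^ 2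

variable {B : E →L[ℝ] E →L[ℝ] ℝ} {ε : ℝ}

theorem IsStronglyDissipativeOn.norm_sub_le {F : E → E} {s : Set E}
    (h : IsStronglyDissipativeOn B ε F s) (hε : 0 < ε) {η η' : E} (hη : η ∈ s) (hη' : η' ∈ s) :
    ‖η - η'‖ ≤ ‖B‖ / ε * ‖F η - F η'‖ := by
  have hdiss := h η hη η' hη'
  have hB := (neg_abs_le _).trans' (neg_le_neg (B.le_opNorm₂ (η - η') (F η - F η')))
  rw [div_mul_eq_mul_div, le_div_iff₀' hε]
  rcases (norm_nonneg (η - η')).eq_or_lt with h₀ | hpos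
  · rw [← h₀, mul_zero]
    positivity
  · nlinarith

theorem IsStronglyDissipativeOn.eq_of_eq_zero {F : E → E} {s : Set E}
    (h : IsStronglyDissipativeOn B ε F s) (hε : 0 < ε) {η η' : E} (hη : η ∈ s) (hη' : η' ∈ s)
    (h₀ : F η = 0) (h₀' : F η' = 0) : η = η' := by
  have := h.norm_sub_le hε hη hη'
  rw [h₀, h₀', sub_self, norm_zero, mul_zero] at this
  exact sub_eq_zero.1 (norm_le_zero_iff.1 this)

theorem IsStronglyDissipativeOn.continuousOn_of_eq_zero {W : Type*} [TopologicalSpace W]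
    {T : Set W} {F : W → E → E} {s : W → Set E} (hε : 0 < ε)
    (h : ∀ w ∈ T, IsStronglyDissipativeOn B ε (F w) (s w)) (hs : ∀ η, IsOpen {w | η ∈ s w})
    (hF : ∀ w η, η ∈ s w → ContinuousAt (fun w' ↦ F w' η) w) {e : W → E}
    (hes : ∀ w ∈ T, e w ∈ s w) (he : ∀ w ∈ T, F w (e w) = 0) : ContinuousOn e T := by
  intro w hw
  have hlim : Tendsto (fun w' ↦ ‖B‖ / ε * ‖F w' (e w)‖) (𝓝[T] w) (𝓝 0) := by
    have := (hF w _ (hes w hw)).norm.const_mul (‖B‖ / ε)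
    simp only [ContinuousAt, he w hw, norm_zero, mul_zero] at this
    exact this.mono_left nhdsWithin_le_nhds
  refine tendsto_iff_norm_sub_tendsto_zero.2 (squeeze_zero' (by simp) ?_ hlim)
  filter_upwards [mem_nhdsWithin_of_mem_nhds ((hs (e w)).mem_nhds (hes w hw)),
    self_mem_nhdsWithin] with w' hmem hw'
  have := (h w' hw').norm_sub_le hε hmem (hes w' hw')
  rwa [he w' hw', sub_zero, norm_sub_rev] at this

end Dissipative

section TwoTimescale

open Filter Topology

theorem exists_timescale_separation {α ε : ℝ} (hα : 0 < α) (hε : 0 < ε) (L M : ℝ) :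
    ∃ τ₀ > 0, ∀ τ : ℝ, τ₀ ≤ τ → ∀ a y : ℝ,
      -α * a ^ 2 + τ⁻¹ * (M * (a * (y + a)) + (-ε * y ^ 2 + L * (y * a))) ≤
        -(α / 2 * a ^ 2 + τ⁻¹ * (ε / 2) * y ^ 2) := by
  refine ⟨max 1 (2 / α * (M + (L + M) ^ 2 / (2 * ε))), by positivity, fun τ hτ a y ↦ ?_⟩
  have hτ₀ : 0 < τ := one_pos.trans_le ((le_max_left _ _).trans hτ)
  have hthreshold : M + (L + M) ^ 2 / (2 * ε) ≤ α / 2 * τ := by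
    have := (le_max_right _ _).trans hτ
    rw [div_mul_eq_mul_div, div_le_iff₀ hα] at this
    linarith
  have hyoung : (L + M) * (y * a) ≤ ε / 2 * y ^ 2 + (L + M) ^ 2 / (2 * ε) * a ^ 2 := by
    have hsquare : ε / 2 * y ^ 2 + (L + M) ^ 2 / (2 * ε) * a ^ 2 - (L + M) * (y * a) =
        (ε * y - (L + M) * a) ^ 2 / (2 * ε) := by field_simp; ring
    have : 0 ≤ (ε * y - (L + M) * a) ^ 2 / (2 * ε) := by positivity
    linarith
  have hslow : M * (a * (y + a)) + (-ε * y ^ 2 + L * (y * a)) ≤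
      τ * (α / 2 * a ^ 2) - ε / 2 * y ^ 2 := by
    nlinarith [mul_le_mul_of_nonneg_right hthreshold (sq_nonneg a)]
  have hscaled := mul_le_mul_of_nonneg_left hslow (inv_nonneg.2 hτ₀.le)
  rw [mul_sub, inv_mul_cancel_left₀ hτ₀.ne'] at hscaled
  linarith

theorem bilin_le_of_lipschitzOnWith {X H : Type*} [SeminormedAddCommGroup X] [NormedAddCommGroup H]
    [NormedSpace ℝ H] {BH : H →L[ℝ] H →L[ℝ] ℝ} {Φ : X × H → H} {U : Set (X × H)} {K : NNReal}
    (hΦ : LipschitzOnWith K Φ U) {x x' : X} {η : H} (hx : (x, η) ∈ U) (hx' : (x', η) ∈ U) {y : H}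
    {b : ℝ} (h : BH y (Φ (x', η)) ≤ b) :
    BH y (Φ (x, η)) ≤ b + ‖BH‖ * K * (‖y‖ * ‖x - x'‖) := by
  have hdist : ‖(x, η) - (x', η)‖ = ‖x - x'‖ := by
    rw [Prod.mk_sub_mk, sub_self, Prod.norm_mk, norm_zero, max_eq_left (norm_nonneg _)]
  have hdiff : BH y (Φ (x, η) - Φ (x', η)) ≤ ‖BH‖ * ‖y‖ * (K * ‖x - x'‖) :=
    (le_abs_self _).trans <| (BH.le_opNorm₂ _ _).trans <| by
      gcongr; exact hdist ▸ hΦ.norm_sub_le hx hx'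
  rw [map_sub] at hdiff
  linarith

variable {X H : Type*} [NormedAddCommGroup X] [NormedSpace ℝ X] [NormedAddCommGroup H]
  [NormedSpace ℝ H]

theorem norm_prod_le_of_shear (Γ : H →L[ℝ] X) (v : X × H) :
    ‖v‖ ≤ (‖Γ‖ + 1) * (‖v.2‖ + ‖v.1 - Γ v.2‖) := by
  have hfst : ‖v.1‖ ≤ ‖v.1 - Γ v.2‖ + ‖Γ‖ * ‖v.2‖ :=
    (norm_le_norm_sub_add v.1 (Γ v.2)).trans (by gcongr; exact Γ.le_opNorm _)
  have hmul : 0 ≤ ‖Γ‖ * ‖v.1 - Γ v.2‖ := by positivity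
  refine max_le ?_ ?_ <;>
    nlinarith [mul_nonneg (norm_nonneg Γ) (norm_nonneg v.2), norm_nonneg (v.1 - Γ v.2),
      norm_nonneg v.2]

theorem mul_norm_prod_sq_le_of_shear (Γ : H →L[ℝ] X) (v : X × H) {a b : ℝ} (ha : 0 ≤ a)
    (hb : 0 ≤ b) : min a b / (2 * (‖Γ‖ + 1) ^ 2) * ‖v‖ ^ 2 ≤
      a * ‖v.1 - Γ v.2‖ ^ 2 + b * ‖v.2‖ ^ 2 := by
  rw [div_mul_eq_mul_div, div_le_iff₀ (by positivity)]
  calc min a b * ‖v‖ ^ 2 ≤ min a b * ((‖Γ‖ + 1) * (‖v.2‖ + ‖v.1 - Γ v.2‖)) ^ 2 := by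
        have := le_min ha hb
        gcongr
        exact norm_prod_le_of_shear Γ v
    _ ≤ min a b * ((‖Γ‖ + 1) ^ 2 * (2 * (‖v.2‖ ^ 2 + ‖v.1 - Γ v.2‖ ^ 2))) := by
        have := le_min ha hb
        rw [mul_pow]
        gcongr
        exact add_sq_le
    _ = (min a b * ‖v.1 - Γ v.2‖ ^ 2 + min a b * ‖v.2‖ ^ 2) * (2 * (‖Γ‖ + 1) ^ 2) := by ring
    _ ≤ (a * ‖v.1 - Γ v.2‖ ^ 2 + b * ‖v.2‖ ^ 2) * (2 * (‖Γ‖ + 1) ^ 2) := by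
        gcongr
        exacts [min_le_left a b, min_le_right a b]

/-- The composite Lyapunov form `BX (x - Γ η) (x - Γ η) + BH η η` of a two-time-scale system whose
fast state `x` relaxes to `Γ η`. -/
def compositeForm (BX : X →L[ℝ] X →L[ℝ] ℝ) (BH : H →L[ℝ] H →L[ℝ] ℝ) (Γ : H →L[ℝ] X) :
    X × H →L[ℝ] X × H →L[ℝ] ℝ :=
  let shear := ContinuousLinearMap.fst ℝ X H - Γ.comp (ContinuousLinearMap.snd ℝ X H)
  BX.bilinearComp shear shear +
    BH.bilinearComp (ContinuousLinearMap.snd ℝ X H) (ContinuousLinearMap.snd ℝ X H)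

variable {A : X →L[ℝ] X} {Γ : H →L[ℝ] X} {BX : X →L[ℝ] X →L[ℝ] ℝ} {BH : H →L[ℝ] H →L[ℝ] ℝ}

theorem compositeForm_apply (v w : X × H) :
    compositeForm BX BH Γ v w = BX (v.1 - Γ v.2) (w.1 - Γ w.2) + BH v.2 w.2 := rfl

theorem compositeForm_le {α τ M : ℝ} (hτ : 0 ≤ τ) (hA : ∀ x, BX x (A x) ≤ -α * ‖x‖ ^ 2) {b : ℝ}
    {v : X × H} {φ : H} (hφ : ‖φ‖ ≤ M * (‖v.2‖ + ‖v.1 - Γ v.2‖)) (hBφ : BH v.2 φ ≤ b) :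
    compositeForm BX BH Γ v (A (v.1 - Γ v.2), τ⁻¹ • φ) ≤ -α * ‖v.1 - Γ v.2‖ ^ 2 +
      τ⁻¹ * (‖BX‖ * ‖Γ‖ * M * (‖v.1 - Γ v.2‖ * (‖v.2‖ + ‖v.1 - Γ v.2‖)) + b) := by
  set a := v.1 - Γ v.2 with ha
  have hcoupling : -(BX a (Γ φ)) ≤ ‖BX‖ * ‖Γ‖ * M * (‖a‖ * (‖v.2‖ + ‖a‖)) :=
    calc -(BX a (Γ φ)) ≤ ‖BX‖ * ‖a‖ * ‖Γ φ‖ := (neg_le_abs _).trans (BX.le_opNorm₂ a (Γ φ))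
      _ ≤ ‖BX‖ * ‖a‖ * (‖Γ‖ * (M * (‖v.2‖ + ‖a‖))) := by
        gcongr
        exact Γ.le_opNorm_of_le hφ
      _ = ‖BX‖ * ‖Γ‖ * M * (‖a‖ * (‖v.2‖ + ‖a‖)) := by ring
  rw [compositeForm_apply, ← ha]
  simp only [map_sub, map_smul, smul_eq_mul]
  have := mul_le_mul_of_nonneg_left (add_le_add hcoupling hBφ) (inv_nonneg.2 hτ)
  linarith [hA a]

theorem exists_lipschitzOnWith_twoTimescale (A : X →L[ℝ] X) (Γ : H →L[ℝ] X) (x₀ : X) (c : ℝ)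
    {Φ : X × H → H} {U : Set (X × H)} {K : NNReal} (hΦ : LipschitzOnWith K Φ U) :
    ∃ K', LipschitzOnWith K' (fun ξ ↦ (A (ξ.1 - (x₀ + Γ ξ.2)), c • Φ ξ)) U :=
  have hfast : LipschitzWith _ fun ξ : X × H ↦ A (ξ.1 - (x₀ + Γ ξ.2)) :=
    A.lipschitz.comp (LipschitzWith.prod_fst.sub
      ((LipschitzWith.const x₀).add (Γ.lipschitz.comp LipschitzWith.prod_snd)))
  ⟨_, hfast.lipschitzOnWith.prodMk ((lipschitzWith_smul c).comp_lipschitzOnWith hΦ)⟩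

/- The threshold depends only on the listed constants, not on the equilibrium `η₀`, the offset `x₀`
or the slow field `Φ`: this is what makes it uniform over the exogenous signals. -/
theorem exists_isLocallyExpStable_twoTimescale [FiniteDimensional ℝ X] [FiniteDimensional ℝ H]
    (Γ : H →L[ℝ] X) (hBX : ∀ x y, BX x y = BX y x) (hBH : ∀ x y, BH x y = BH y x)
    {cX cH α ε : ℝ} (hcX : 0 < cX) (hcH : 0 < cH) (hα : 0 < α) (hε : 0 < ε)
    (hX : ∀ x, cX * ‖x‖ ^ 2 ≤ BX x x) (hH : ∀ y, cH * ‖y‖ ^ 2 ≤ BH y y)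
    (hA : ∀ x, BX x (A x) ≤ -α * ‖x‖ ^ 2) (K : NNReal) :
    ∃ τ₀ > 0, ∀ τ : ℝ, τ₀ ≤ τ → ∀ (x₀ : X) (η₀ : H) (Φ : X × H → H) (dom U : Set (X × H)),
      U ∈ 𝓝 (x₀ + Γ η₀, η₀) → U ⊆ dom → LipschitzOnWith K Φ U → Φ (x₀ + Γ η₀, η₀) = 0 →
      (∀ η, (x₀ + Γ η, η) ∈ U → BH (η - η₀) (Φ (x₀ + Γ η, η)) ≤ -ε * ‖η - η₀‖ ^ 2) →
      IsLocallyExpStable (fun ξ ↦ (A (ξ.1 - (x₀ + Γ ξ.2)), τ⁻¹ • Φ ξ)) dom (x₀ + Γ η₀, η₀) := by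
  obtain ⟨τ₀, hτ₀, hsep⟩ := exists_timescale_separation hα hε (‖BH‖ * K)
    (‖BX‖ * ‖Γ‖ * (K * (‖Γ‖ + 1)))
  refine ⟨τ₀, hτ₀, fun τ hτ x₀ η₀ Φ dom U hU hdom hΦ hzero hdiss ↦ ?_⟩
  have hτpos : 0 < τ := hτ₀.trans_le hτ
  have hslowU : (fun ξ ↦ (x₀ + Γ ξ.2, ξ.2)) ⁻¹' U ∈ 𝓝 (x₀ + Γ η₀, η₀) :=
    (by fun_prop : Continuous fun ξ : X × H ↦ (x₀ + Γ ξ.2, ξ.2)).continuousAt.preimage_mem_nhds hU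
  obtain ⟨K', hlip⟩ := exists_lipschitzOnWith_twoTimescale A Γ x₀ τ⁻¹ hΦ
  refine isLocallyExpStable_of_lyapunov (B := compositeForm BX BH Γ)
    (c := min cX cH / (2 * (‖Γ‖ + 1) ^ 2))
    (lam := min (α / 2) (τ⁻¹ * (ε / 2)) / (2 * (‖Γ‖ + 1) ^ 2))
    (fun v w ↦ by rw [compositeForm_apply, compositeForm_apply, hBX, hBH]) (by positivity)
    (fun v ↦ (mul_norm_prod_sq_le_of_shear Γ v hcX.le hcH.le).trans (add_le_add (hX _) (hH _)))
    (inter_mem hU hslowU) (inter_subset_left.trans hdom) (hlip.mono inter_subset_left)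
    (by positivity) ?_
  rintro ξ ⟨hξ, hξslow⟩
  set v := ξ - (x₀ + Γ η₀, η₀) with hv
  have hshear : ξ.1 - (x₀ + Γ ξ.2) = v.1 - Γ v.2 := by
    simp only [hv, Prod.fst_sub, Prod.snd_sub, map_sub]
    abel
  have hbound : ‖Φ ξ‖ ≤ K * (‖Γ‖ + 1) * (‖v.2‖ + ‖v.1 - Γ v.2‖) := by
    have := hΦ.norm_sub_le hξ (mem_of_mem_nhds hU)
    rw [hzero, sub_zero] at this
    rw [mul_assoc]
    exact this.trans (by gcongr; exact norm_prod_le_of_shear Γ v)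
  have hslow := bilin_le_of_lipschitzOnWith hΦ hξ hξslow (hdiss ξ.2 hξslow)
  rw [hshear] at hslow ⊢
  rw [neg_mul]
  exact (compositeForm_le hτpos.le hA hbound hslow).trans ((hsep τ hτ _ _).trans
    (neg_le_neg (mul_norm_prod_sq_le_of_shear Γ v (by positivity) (by positivity))))

end TwoTimescale

/-! ### Quadratic forms and linear maps given by matrices -/

section MatrixForm

variable {V κ : Type*} [NormedAddCommGroup V] [NormedSpace ℝ V] [FiniteDimensional ℝ V]
  [Fintype κ]

theorem exists_pos_mul_norm_sq_le_dotProduct_self {J : V →ₗ[ℝ] κ → ℝ}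
    (hJ : Function.Injective J) : ∃ c > 0, ∀ v, c * ‖v‖ ^ 2 ≤ J v ⬝ᵥ J v := by
  let toEuclidean : V →ₗ[ℝ] EuclideanSpace ℝ κ := (WithLp.linearEquiv 2 ℝ (κ → ℝ)).symm ∘ₗ J
  have hker : LinearMap.ker toEuclidean = ⊥ :=
    LinearMap.ker_eq_bot.2 ((WithLp.linearEquiv 2 ℝ (κ → ℝ)).symm.injective.comp hJ)
  obtain ⟨C, hC, hanti⟩ := toEuclidean.exists_antilipschitzWith hker
  refine ⟨((C : ℝ) ^ 2)⁻¹, by positivity, fun v ↦ ?_⟩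
  have hnorm : J v ⬝ᵥ J v = ‖toEuclidean v‖ ^ 2 := ofLp_dotProduct_ofLp_self (toEuclidean v)
  rw [hnorm, inv_mul_le_iff₀ (by positivity), ← mul_pow]
  gcongr
  exact hanti.le_mul_norm (map_zero toEuclidean) v

variable [DecidableEq κ]

/-- The bilinear form `(x, y) ↦ (J x)ᵀ P (J y)`, where `J` stands for the choice of coordinates. -/
def matrixForm (J : V →ₗ[ℝ] κ → ℝ) (P : Matrix κ κ ℝ) : V →L[ℝ] V →L[ℝ] ℝ :=
  ((toLinearMap₂' ℝ P).compl₁₂ J J).toContinuousBilinearMap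

variable {J : V →ₗ[ℝ] κ → ℝ} {P : Matrix κ κ ℝ}

theorem matrixForm_apply (x y : V) : matrixForm J P x y = J x ⬝ᵥ (P *ᵥ J y) := by
  rw [matrixForm, LinearMap.toContinuousBilinearMap_apply, LinearMap.compl₁₂_apply,
    toLinearMap₂'_apply']

theorem matrixForm_comm (hP : P.IsSymm) (x y : V) : matrixForm J P x y = matrixForm J P y x := by
  rw [matrixForm_apply, matrixForm_apply, dotProduct_mulVec_comm hP]

theorem exists_pos_mul_norm_sq_le_matrixForm (hJ : Function.Injective J) (hP : P.PosDef) :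
    ∃ c > 0, ∀ v, c * ‖v‖ ^ 2 ≤ matrixForm J P v v := by
  obtain ⟨a, ha, hPa⟩ := exists_pos_mul_dotProduct_le hP
  obtain ⟨b, hb, hJb⟩ := exists_pos_mul_norm_sq_le_dotProduct_self hJ
  refine ⟨a * b, mul_pos ha hb, fun v ↦ ?_⟩
  rw [matrixForm_apply, mul_assoc]
  exact (mul_le_mul_of_nonneg_left (hJb v) ha.le).trans (hPa _)

end MatrixForm

/-- The coordinates of a pair of Euclidean vectors. -/
def pairVec (q nc : ℕ) :
    (EuclideanSpace ℝ (Fin q) × EuclideanSpace ℝ (Fin nc)) ≃ₗ[ℝ] (Fin q ⊕ Fin nc → ℝ) :=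
  ((WithLp.linearEquiv 2 ℝ (Fin q → ℝ)).prodCongr (WithLp.linearEquiv 2 ℝ (Fin nc → ℝ))).trans
    (LinearEquiv.sumArrowLequivProdArrow (Fin q) (Fin nc) ℝ ℝ).symm

theorem pairVec_apply {q nc : ℕ} (η : EuclideanSpace ℝ (Fin q) × EuclideanSpace ℝ (Fin nc)) :
    pairVec q nc η = Sum.elim η.1.ofLp η.2.ofLp := rfl

section Mlin

variable {k l o : ℕ}

/-- The continuous linear map of Euclidean spaces given by a matrix. -/
def mlin (M : Matrix (Fin k) (Fin l) ℝ) : EuclideanSpace ℝ (Fin l) →L[ℝ] EuclideanSpace ℝ (Fin k) :=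
  (toEuclideanLin M).toContinuousLinearMap

theorem toEuclideanLin_eq_mlin (M : Matrix (Fin k) (Fin l) ℝ) (x : EuclideanSpace ℝ (Fin l)) :
    toEuclideanLin M x = mlin M x := rfl

theorem ofLp_mlin (M : Matrix (Fin k) (Fin l) ℝ) (x : EuclideanSpace ℝ (Fin l)) :
    (mlin M x).ofLp = M *ᵥ x.ofLp := rfl

theorem mlin_mul_apply (M : Matrix (Fin k) (Fin l) ℝ) (N : Matrix (Fin l) (Fin o) ℝ)
    (x : EuclideanSpace ℝ (Fin o)) : mlin (M * N) x = mlin M (mlin N x) :=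
  WithLp.ofLp_injective 2 (mulVec_mulVec x.ofLp M N).symm

theorem mlin_one_apply (x : EuclideanSpace ℝ (Fin k)) : mlin 1 x = x :=
  WithLp.ofLp_injective 2 (one_mulVec x.ofLp)

theorem inner_mlin (M : Matrix (Fin k) (Fin l) ℝ) (x : EuclideanSpace ℝ (Fin k))
    (y : EuclideanSpace ℝ (Fin l)) : inner ℝ x (mlin M y) = inner ℝ (mlin Mᵀ x) y := by
  rw [EuclideanSpace.inner_eq_star_dotProduct, EuclideanSpace.inner_eq_star_dotProduct, ofLp_mlin,
    ofLp_mlin, star_trivial, star_trivial, dotProduct_transpose_mulVec, dotProduct_comm]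

end Mlin

theorem IsHurwitz.exists_lyapunov_form {n : ℕ} {A : Matrix (Fin n) (Fin n) ℝ} (hA : IsHurwitz A) :
    ∃ B : EuclideanSpace ℝ (Fin n) →L[ℝ] EuclideanSpace ℝ (Fin n) →L[ℝ] ℝ,
      (∀ x y, B x y = B y x) ∧ (∃ c > 0, ∀ x, c * ‖x‖ ^ 2 ≤ B x x) ∧
        ∃ α > 0, ∀ x, B x (mlin A x) ≤ -α * ‖x‖ ^ 2 := by
  obtain ⟨P, hP, α, hα, hPA⟩ := hA.exists_lyapunov
  let coords := (WithLp.linearEquiv 2 ℝ (Fin n → ℝ)).toLinearMap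
  have hsymm : P.IsSymm := isHermitian_iff_isSymm.1 hP.isHermitian
  refine ⟨matrixForm coords P, matrixForm_comm hsymm,
    exists_pos_mul_norm_sq_le_matrixForm (WithLp.linearEquiv 2 ℝ _).injective hP, α, hα, fun x ↦ ?_⟩
  rw [matrixForm_apply, ← ofLp_dotProduct_ofLp_self]
  exact hPA x.ofLp

/-! ### The closed loop as a two-time-scale system -/

namespace Data

variable {n m r nc nw q : ℕ} (S : Data n m r nc nw)
  (Tz : Matrix (Fin r) (Fin q) ℝ) (Tu : Matrix (Fin m) (Fin q) ℝ)
  (K : Matrix (Fin m) (Fin q ⊕ Fin nc) ℝ)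

/-- State `(η₁, η₂)` of the controller. -/
abbrev ControllerState (q nc : ℕ) : Type :=
  EuclideanSpace ℝ (Fin q) × EuclideanSpace ℝ (Fin nc)

/-- The feedback law `η ↦ K₁ η₁ + K₂ η₂`. -/
def gain : ControllerState q nc →L[ℝ] EuclideanSpace ℝ (Fin m) :=
  (mlin K.toCols₁).coprod (mlin K.toCols₂)

theorem input_eq_gain (ξ : State n q nc) : input K ξ = gain K ξ.2 := rfl

theorem ofLp_gain (η : ControllerState q nc) : (gain K η).ofLp = K *ᵥ pairVec q nc η := by
  conv_rhs => rw [← fromCols_toCols K, pairVec_apply, fromCols_mulVec]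
  rfl

/-- Steady-state output of the plant for constant `w` and `u`. -/
def dcOutput (w : EuclideanSpace ℝ (Fin nw)) (u : EuclideanSpace ℝ (Fin m)) :
    EuclideanSpace ℝ (Fin r) :=
  mlin S.Gu u + mlin S.Gw w

/-- Part of the steady state of the plant that is due to `w`. -/
def dcOffset (w : EuclideanSpace ℝ (Fin nw)) : EuclideanSpace ℝ (Fin n) :=
  -(mlin S.A⁻¹ (mlin S.Bw w))

/-- Part of the steady state of the plant that is due to the controller state. -/
def dcGain : ControllerState q nc →L[ℝ] EuclideanSpace ℝ (Fin n) :=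
  -(mlin S.A⁻¹ ∘L mlin S.B ∘L gain K)

/-- The state in which the plant is at its steady state for the frozen controller state `η`. -/
def steadyState (w : EuclideanSpace ℝ (Fin nw)) (η : ControllerState q nc) : State n q nc :=
  (S.dcOffset w + S.dcGain K η, η)

/-- Right side of the controller equation, without the time constants. -/
def controllerField (w : EuclideanSpace ℝ (Fin nw)) (u : EuclideanSpace ℝ (Fin m))
    (z : EuclideanSpace ℝ (Fin r)) : ControllerState q nc :=
  (-(mlin Tuᵀ (gradient S.f₀ u) + mlin Tzᵀ (gradient S.g₀ z)), -S.violation w u z)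

/-- Right side of the reduced dynamics: the controller in closed loop with the plant replaced by
its steady-state input-output map. -/
def reducedField (w : EuclideanSpace ℝ (Fin nw)) (η : ControllerState q nc) :
    ControllerState q nc :=
  S.controllerField Tz Tu w (gain K η) (S.dcOutput w (gain K η))

/-- Controller states at which the reduced dynamics are defined. -/
def reducedDomain (w : EuclideanSpace ℝ (Fin nw)) : Set (ControllerState q nc) :=
  {η | gain K η ∈ interior S.Uset ∧ S.dcOutput w (gain K η) ∈ interior S.Zset}

theorem dcOutput_sub (w : EuclideanSpace ℝ (Fin nw)) (u u' : EuclideanSpace ℝ (Fin m)) :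
    S.dcOutput w u - S.dcOutput w u' = mlin S.Gu (u - u') := by
  rw [dcOutput, dcOutput, add_sub_add_right_eq_sub, map_sub]

theorem output_steadyState (w : EuclideanSpace ℝ (Fin nw)) (η : ControllerState q nc) :
    S.output K w (S.steadyState K w η) = S.dcOutput w (gain K η) := by
  apply WithLp.ofLp_injective
  simp only [output, input_eq_gain, steadyState, dcOffset, dcGain, dcOutput, Gu, Gw,
    toEuclideanLin_eq_mlin, _root_.neg_apply, ContinuousLinearMap.comp_apply,
    WithLp.ofLp_add, WithLp.ofLp_neg, ofLp_mlin, mulVec_add, mulVec_neg, add_mulVec, neg_mulVec,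
    ← mulVec_mulVec]
  abel

theorem steadyState_mem_domain {w : EuclideanSpace ℝ (Fin nw)} {η : ControllerState q nc} :
    S.steadyState K w η ∈ S.domain K w ↔ η ∈ S.reducedDomain K w := by
  rw [domain, mem_ofPred_eq, output_steadyState]
  rfl

theorem closedLoop_eq (hA : IsUnit S.A.det) (τ : ℝ) (w : EuclideanSpace ℝ (Fin nw)) :
    S.closedLoop Tz Tu K τ τ w = fun ξ ↦
      (mlin S.A (ξ.1 - (S.dcOffset w + S.dcGain K ξ.2)),
        τ⁻¹ • S.controllerField Tz Tu w (input K ξ) (S.output K w ξ)) := by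
  ext1 ξ
  have hAinv (x : EuclideanSpace ℝ (Fin n)) : mlin S.A (mlin S.A⁻¹ x) = x := by
    rw [← mlin_mul_apply, mul_nonsing_inv _ hA, mlin_one_apply]
  have hplant : mlin S.A (ξ.1 - (S.dcOffset w + S.dcGain K ξ.2)) =
      mlin S.A ξ.1 + mlin S.B (input K ξ) + mlin S.Bw w := by
    simp only [dcOffset, dcGain, _root_.neg_apply, ContinuousLinearMap.comp_apply,
      map_sub, map_add, map_neg, hAinv, input_eq_gain]
    abel
  rw [hplant, controllerField, Prod.smul_mk, smul_neg, smul_neg]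
  rfl

theorem isEquilibrium_closedLoop_iff (hA : IsUnit S.A.det) {τ : ℝ} (hτ : τ ≠ 0)
    {w : EuclideanSpace ℝ (Fin nw)} {p : State n q nc} :
    IsEquilibrium (S.closedLoop Tz Tu K τ τ w) (S.domain K w) p ↔
      p = S.steadyState K w p.2 ∧ p.2 ∈ S.reducedDomain K w ∧
        S.reducedField Tz Tu K w p.2 = 0 := by
  have hAinj : ∀ x, mlin S.A x = 0 ↔ x = 0 := fun x ↦ by
    refine ⟨fun hx ↦ ?_, fun hx ↦ by rw [hx, map_zero]⟩
    rw [← mlin_one_apply x, ← nonsing_inv_mul _ hA, mlin_mul_apply, hx, map_zero]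
  have hplant : mlin S.A (p.1 - (S.dcOffset w + S.dcGain K p.2)) = 0 ↔
      p = S.steadyState K w p.2 := by
    rw [hAinj, sub_eq_zero, steadyState, Prod.ext_iff, and_iff_left rfl]
  rw [IsEquilibrium, closedLoop_eq S Tz Tu K hA, Prod.mk_eq_zero, hplant, smul_eq_zero_iff_right
    (inv_ne_zero hτ), and_left_comm]
  refine and_congr_right fun hp ↦ ?_
  have hout : S.output K w p = S.dcOutput w (gain K p.2) := by
    conv_lhs => rw [hp, output_steadyState]
  rw [reducedField, ← hout, ← S.steadyState_mem_domain, ← hp, input_eq_gain]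

end Data

/-! ### Dissipativity of the reduced dynamics -/

namespace Data

variable {n m r nc nw q : ℕ} {S : Data n m r nc nw}
  {Tz : Matrix (Fin r) (Fin q) ℝ} {Tu : Matrix (Fin m) (Fin q) ℝ}
  {Q₁ : Matrix (Fin m) (Fin m) ℝ} {Q₂ : Matrix (Fin r) (Fin r) ℝ}
  {Θ₁ : Matrix (Fin m ⊕ Fin m) (Fin m ⊕ Fin m) ℝ}
  {Θ₂ : Matrix (Fin r ⊕ Fin r) (Fin r ⊕ Fin r) ℝ} {ρ γ : ℝ}
  {Y : Matrix (Fin q ⊕ Fin nc) (Fin q ⊕ Fin nc) ℝ} {Z : Matrix (Fin m) (Fin q ⊕ Fin nc) ℝ}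
  {θ₁ θ₂ : ℝ}

theorem lfr_mulVec (v p₁ : Fin m → ℝ) (p₂ : Fin r → ℝ) :
    S.lfrB Tz Tu Q₁ Q₂ *ᵥ v + lfrB₁ nc Tz Tu *ᵥ Sum.elim p₁ p₂ =
      Sum.elim (-(Tuᵀ *ᵥ (Q₁ *ᵥ v + p₁) + Tzᵀ *ᵥ (Q₂ *ᵥ (S.Gu *ᵥ v) + p₂)))
        (-(S.Hz *ᵥ (S.Gu *ᵥ v) + S.Hu *ᵥ v)) := by
  rw [lfrB, lfrB₁, fromRows_mulVec, fromRows_mulVec, fromCols_mulVec, Sum.elim_comp_inl,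
    Sum.elim_comp_inr, zero_mulVec, ← Sum.elim_add_add, add_zero, Qred, N]
  simp only [mulVec_add, add_mulVec, neg_mulVec, ← mulVec_mulVec]
  congr 1
  abel

theorem pairVec_controllerField_sub (w : EuclideanSpace ℝ (Fin nw))
    (u u' : EuclideanSpace ℝ (Fin m)) (z z' : EuclideanSpace ℝ (Fin r)) :
    pairVec q nc (S.controllerField Tz Tu w u z - S.controllerField Tz Tu w u' z') =
      Sum.elim
        (-(Tuᵀ *ᵥ (gradient S.f₀ u - gradient S.f₀ u').ofLp +
          Tzᵀ *ᵥ (gradient S.g₀ z - gradient S.g₀ z').ofLp))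
        (-(S.Hz *ᵥ (z - z').ofLp + S.Hu *ᵥ (u - u').ofLp)) := by
  simp only [pairVec_apply, controllerField, violation, toEuclideanLin_eq_mlin, Prod.mk_sub_mk,
    WithLp.ofLp_add, WithLp.ofLp_sub, WithLp.ofLp_neg, ofLp_mlin, mulVec_sub]
  congr 1 <;> abel

theorem mulVec_inv_mulVec_pairVec (η : ControllerState q nc) :
    Z *ᵥ (Y⁻¹ *ᵥ pairVec q nc η) = (gain (Z * Y⁻¹) η).ofLp := by
  rw [ofLp_gain, mulVec_mulVec]

theorem exists_pos_mul_norm_sq_le_mulVec_pairVec (hY : IsUnit Y) :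
    ∃ c > 0, ∀ η : ControllerState q nc,
      c * ‖η‖ ^ 2 ≤ (Y *ᵥ pairVec q nc η) ⬝ᵥ (Y *ᵥ pairVec q nc η) :=
  exists_pos_mul_norm_sq_le_dotProduct_self (J := Y.mulVecLin ∘ₗ (pairVec q nc).toLinearMap)
    ((mulVec_injective_of_isUnit hY).comp (pairVec q nc).injective)

section Sector

variable {Δ₁ : EuclideanSpace ℝ (Fin m) → EuclideanSpace ℝ (Fin m)}
  {Δ₂ : EuclideanSpace ℝ (Fin r) → EuclideanSpace ℝ (Fin r)}
  (hf : ∀ v ∈ interior S.Uset, gradient S.f₀ v = toEuclideanLin Q₁ v + Δ₁ v)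
  (hg : ∀ v ∈ interior S.Zset, gradient S.g₀ v = toEuclideanLin Q₂ v + Δ₂ v)

include hf hg in
theorem pairVec_reducedField_sub {K : Matrix (Fin m) (Fin q ⊕ Fin nc) ℝ}
    {w : EuclideanSpace ℝ (Fin nw)} {η η' : ControllerState q nc}
    (hη : η ∈ S.reducedDomain K w) (hη' : η' ∈ S.reducedDomain K w) :
    pairVec q nc (S.reducedField Tz Tu K w η - S.reducedField Tz Tu K w η') =
      S.lfrB Tz Tu Q₁ Q₂ *ᵥ (gain K η - gain K η').ofLp + lfrB₁ nc Tz Tu *ᵥ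
        Sum.elim (Δ₁ (gain K η) - Δ₁ (gain K η')).ofLp
          (Δ₂ (S.dcOutput w (gain K η)) - Δ₂ (S.dcOutput w (gain K η'))).ofLp := by
  have hgrad {k : ℕ} (Q : Matrix (Fin k) (Fin k) ℝ) (v v' d d' : EuclideanSpace ℝ (Fin k)) :
      (toEuclideanLin Q v + d - (toEuclideanLin Q v' + d')).ofLp =
        Q *ᵥ (v - v').ofLp + (d - d').ofLp := by
    rw [add_sub_add_comm, ← map_sub]
    rfl
  rw [reducedField, reducedField, pairVec_controllerField_sub, hf _ hη.1, hf _ hη'.1,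
    hg _ hη.2, hg _ hη'.2, hgrad, hgrad, dcOutput_sub, ofLp_mlin, lfr_mulVec]

variable (h : S.SynthesisLMI Tz Tu Q₁ Q₂ Θ₁ Θ₂ ρ γ Y Z θ₁ θ₂)
  (hΘ₁ : IsSectorMultiplier (interior S.Uset) Δ₁ Θ₁)
  (hΘ₂ : IsSectorMultiplier (interior S.Zset) Δ₂ Θ₂)
include h hΘ₁ hΘ₂

include hf hg in
theorem SynthesisLMI.exists_isStronglyDissipativeOn :
    ∃ ε > 0, ∀ w, IsStronglyDissipativeOn (matrixForm (pairVec q nc).toLinearMap Y⁻¹) ε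
      (S.reducedField Tz Tu (Z * Y⁻¹) w) (S.reducedDomain (Z * Y⁻¹) w) := by
  obtain ⟨ε, hε, hprimal⟩ := h.exists_primal_le hΘ₁ hΘ₂
  obtain ⟨hY, hθ₁, hθ₂, -⟩ := h
  obtain ⟨c, hc, hbound⟩ := exists_pos_mul_norm_sq_le_mulVec_pairVec hY.inv.isUnit
  refine ⟨ε * c / 2, by positivity, fun w η hη η' hη' ↦ ?_⟩
  have hsymm : (Y⁻¹).IsSymm := isHermitian_iff_isSymm.1 hY.inv.isHermitian
  have hsector₁ := (hΘ₁.smul (inv_pos.2 hθ₁)).sector _ hη.1 _ hη'.1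
  have hsector₂ := (hΘ₂.smul (inv_pos.2 hθ₂)).sector _ hη.2 _ hη'.2
  have hdiss := hprimal (Y⁻¹ *ᵥ pairVec q nc (η - η'))
    (Sum.elim (Δ₁ (gain (Z * Y⁻¹) η) - Δ₁ (gain (Z * Y⁻¹) η')).ofLp
      (Δ₂ (S.dcOutput w (gain (Z * Y⁻¹) η)) - Δ₂ (S.dcOutput w (gain (Z * Y⁻¹) η'))).ofLp)
  rw [← mulVec_mulVec, ← mulVec_mulVec, mulVec_inv_mulVec_pairVec, map_sub (gain _),
    ← pairVec_reducedField_sub hf hg hη hη', lfrE₁, fromRows_mulVec, one_mulVec, ← ofLp_mlin,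
    ← dcOutput_sub S w, dotProduct_daug_mulVec] at hdiss
  rw [matrixForm_comm hsymm, matrixForm_apply, dotProduct_comm]
  simp only [LinearEquiv.coe_coe]
  nlinarith [hbound (η - η')]

theorem SynthesisLMI.gain_injective : Function.Injective (gain (Z * Y⁻¹)) := by
  obtain ⟨ε, hε, hprimal⟩ := h.exists_primal_le hΘ₁ hΘ₂
  obtain ⟨c, hc, hbound⟩ := exists_pos_mul_norm_sq_le_mulVec_pairVec h.1.inv.isUnit
  refine (injective_iff_map_eq_zero _).2 fun η hη ↦ ?_
  have hdiss := hprimal (Y⁻¹ *ᵥ pairVec q nc η) 0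
  rw [← mulVec_mulVec, ← mulVec_mulVec, mulVec_inv_mulVec_pairVec, hη, WithLp.ofLp_zero,
    mulVec_zero, mulVec_zero, mulVec_zero, add_zero, dotProduct_zero, Sum.elim_zero_zero,
    zero_dotProduct] at hdiss
  have hnorm : ‖η‖ ^ 2 ≤ 0 := by
    by_contra! hpos
    nlinarith [hbound η, mul_pos (mul_pos hε hc) hpos]
  exact norm_eq_zero.1 (pow_eq_zero_iff two_ne_zero |>.1 (hnorm.antisymm (sq_nonneg _)))

end Sector

theorem SpansConstraintKernel.le_add (hT : S.SpansConstraintKernel Tz Tu) : m ≤ q + nc := by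
  have hrank := LinearMap.finrank_range_add_finrank_ker (fromBlocks 1 (-S.Gu) S.Hz S.Hu).mulVecLin
  have hker := LinearMap.finrank_range_le (fromRows Tz Tu).mulVecLin
  have hrange := Submodule.finrank_le (LinearMap.range (fromBlocks 1 (-S.Gu) S.Hz S.Hu).mulVecLin)
  rw [hT] at hker
  simp only [Module.finrank_fintype_fun_eq_card, Fintype.card_sum, Fintype.card_fin]
    at hrank hker hrange
  omega

theorem SpansConstraintKernel.gain_surjective (hT : S.SpansConstraintKernel Tz Tu)
    {K : Matrix (Fin m) (Fin q ⊕ Fin nc) ℝ} (hK : Function.Injective (gain K)) :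
    Function.Surjective (gain K) := by
  have hle := LinearMap.finrank_le_finrank_of_injective (f := (gain K).toLinearMap) hK
  have hfinrank : Module.finrank ℝ (ControllerState q nc) =
      Module.finrank ℝ (EuclideanSpace ℝ (Fin m)) := by
    simp only [Module.finrank_prod, finrank_euclideanSpace, Fintype.card_fin] at hle ⊢
    exact hle.antisymm hT.le_add
  exact (LinearMap.injective_iff_surjective_of_finrank_eq_finrank hfinrank).1 hK

end Data

/-! ### First-order optimality conditions -/

theorem hasDerivAt_comp_add_smul {V : Type*} [NormedAddCommGroup V] [InnerProductSpace ℝ V]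
    [CompleteSpace V] {f : V → ℝ} {x : V} (hf : DifferentiableAt ℝ f x) (d : V) :
    HasDerivAt (fun t : ℝ ↦ f (x + t • d)) (inner ℝ (gradient f x) d) 0 := by
  have hline : HasDerivAt (fun t : ℝ ↦ x + t • d) d 0 := by
    simpa using ((hasDerivAt_id (0 : ℝ)).smul_const d).const_add x
  have hgrad : HasFDerivAt f (InnerProductSpace.toDual ℝ V (gradient f x)) (x + (0 : ℝ) • d) := by
    simpa using hf.hasGradientAt.hasFDerivAt
  exact hgrad.comp_hasDerivAt 0 hline

namespace Data

variable {n m r nc nw q : ℕ} {S : Data n m r nc nw}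
  {Tz : Matrix (Fin r) (Fin q) ℝ} {Tu : Matrix (Fin m) (Fin q) ℝ}
  {w : EuclideanSpace ℝ (Fin nw)} {u : EuclideanSpace ℝ (Fin m)} {z : EuclideanSpace ℝ (Fin r)}

theorem SpansConstraintKernel.mlin_eq (hT : S.SpansConstraintKernel Tz Tu)
    (c : EuclideanSpace ℝ (Fin q)) :
    mlin Tz c = mlin S.Gu (mlin Tu c) ∧ mlin S.Hz (mlin Tz c) + mlin S.Hu (mlin Tu c) = 0 := by
  have hmem : fromRows Tz Tu *ᵥ c.ofLp ∈ LinearMap.ker (fromBlocks 1 (-S.Gu) S.Hz S.Hu).mulVecLin :=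
    hT ▸ LinearMap.mem_range_self (fromRows Tz Tu).mulVecLin c.ofLp
  rw [LinearMap.mem_ker, mulVecLin_apply, fromRows_mulVec, fromBlocks_mulVec, Sum.elim_comp_inl,
    Sum.elim_comp_inr, one_mulVec, neg_mulVec, ← sub_eq_add_neg, ← Sum.elim_zero_zero,
    Sum.elim_eq_iff, sub_eq_zero] at hmem
  exact ⟨WithLp.ofLp_injective 2 hmem.1, WithLp.ofLp_injective 2 hmem.2⟩

theorem SpansConstraintKernel.isFeasible_add_smul (hT : S.SpansConstraintKernel Tz Tu)
    (h : S.IsFeasible w u z) (c : EuclideanSpace ℝ (Fin q)) {t : ℝ}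
    (hu : u + t • mlin Tu c ∈ S.Uset) (hz : z + t • mlin Tz c ∈ S.Zset) :
    S.IsFeasible w (u + t • mlin Tu c) (z + t • mlin Tz c) := by
  obtain ⟨-, -, hout, hviol⟩ := h
  obtain ⟨hGu, hH⟩ := hT.mlin_eq c
  simp only [violation, toEuclideanLin_eq_mlin] at hout hviol
  refine ⟨hu, hz, ?_, ?_⟩
  · rw [toEuclideanLin_eq_mlin, toEuclideanLin_eq_mlin, map_add, map_smul, ← hGu, hout]
    abel
  · calc S.violation w (u + t • mlin Tu c) (z + t • mlin Tz c)
        = (mlin S.Hz z + mlin S.Hu u + mlin S.Hw w) +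
            t • (mlin S.Hz (mlin Tz c) + mlin S.Hu (mlin Tu c)) := by
          simp only [violation, toEuclideanLin_eq_mlin, map_add, map_smul, smul_add]
          abel
      _ = 0 := by rw [hviol, hH, smul_zero, add_zero]

theorem IsOptimal.isLocalMin_add_smul (h : S.IsOptimal w u z) (hT : S.SpansConstraintKernel Tz Tu)
    (hu : u ∈ interior S.Uset) (hz : z ∈ interior S.Zset) (c : EuclideanSpace ℝ (Fin q)) :
    IsLocalMin (fun t : ℝ ↦ S.f₀ (u + t • mlin Tu c) + S.g₀ (z + t • mlin Tz c)) 0 := by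
  have hcont {k : ℕ} (v d : EuclideanSpace ℝ (Fin k)) :
      Filter.Tendsto (fun t : ℝ ↦ v + t • d) (nhds 0) (nhds v) := by
    simpa using (Continuous.tendsto (by fun_prop : Continuous fun t : ℝ ↦ v + t • d) 0)
  filter_upwards [hcont u (mlin Tu c) (mem_interior_iff_mem_nhds.1 hu),
    hcont z (mlin Tz c) (mem_interior_iff_mem_nhds.1 hz)] with t hut hzt
  simp only [zero_smul, add_zero]
  exact h.2 _ _ (hT.isFeasible_add_smul h.1 c hut hzt)

theorem IsOptimal.controllerField_eq_zero (h : S.IsOptimal w u z)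
    (hT : S.SpansConstraintKernel Tz Tu) (hu : u ∈ interior S.Uset) (hz : z ∈ interior S.Zset)
    (hf : DifferentiableAt ℝ S.f₀ u) (hg : DifferentiableAt ℝ S.g₀ z) :
    S.controllerField Tz Tu w u z = 0 := by
  set c := mlin Tuᵀ (gradient S.f₀ u) + mlin Tzᵀ (gradient S.g₀ z) with hc
  have hderiv := (h.isLocalMin_add_smul hT hu hz c).hasDerivAt_eq_zero
    ((hasDerivAt_comp_add_smul hf (mlin Tu c)).add (hasDerivAt_comp_add_smul hg (mlin Tz c)))
  rw [inner_mlin, inner_mlin, ← inner_add_left, ← hc, inner_self_eq_zero] at hderiv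
  rw [controllerField, ← hc, hderiv, h.1.2.2.2, neg_zero, neg_zero]
  rfl

theorem SpansConstraintKernel.exists_isOptimal_reducedField_eq_zero
    (hT : S.SpansConstraintKernel Tz Tu) {K : Matrix (Fin m) (Fin q ⊕ Fin nc) ℝ}
    (hK : Function.Surjective (gain K)) (hf : DifferentiableOn ℝ S.f₀ (interior S.Uset))
    (hg : DifferentiableOn ℝ S.g₀ (interior S.Zset))
    (hopt : ∃ u ∈ interior S.Uset, ∃ z ∈ interior S.Zset, S.IsOptimal w u z) :
    ∃ η ∈ S.reducedDomain K w, S.reducedField Tz Tu K w η = 0 ∧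
      S.IsOptimal w (gain K η) (S.dcOutput w (gain K η)) := by
  obtain ⟨u, hu, z, hz, hopt⟩ := hopt
  obtain ⟨η, rfl⟩ := hK u
  obtain rfl : z = S.dcOutput w (gain K η) := hopt.1.2.2.1
  exact ⟨η, ⟨hu, hz⟩, hopt.controllerField_eq_zero hT hu hz
    (hf.differentiableAt (isOpen_interior.mem_nhds hu))
    (hg.differentiableAt (isOpen_interior.mem_nhds hz)), hopt⟩

end Data

/-! ### Stability of the equilibria, uniformly in the exogenous signal -/

theorem exists_isOpen_lipschitzOnWith_of_isCompact {V V' : Type*} [PseudoMetricSpace V]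
    [LocallyCompactSpace V] [PseudoMetricSpace V'] {f : V → V'} {s t : Set V}
    (hf : LocallyLipschitzOn s f) (hs : IsOpen s) (ht : IsCompact t) (hts : t ⊆ s) :
    ∃ L, ∃ u, IsOpen u ∧ t ⊆ u ∧ u ⊆ s ∧ LipschitzOnWith L f u := by
  obtain ⟨k, hk, htk, hks⟩ := exists_compact_between ht hs hts
  obtain ⟨L, hL⟩ := (hf.mono hks).exists_lipschitzOnWith_of_compact hk
  exact ⟨L, interior k, isOpen_interior, htk, interior_subset.trans hks, hL.mono interior_subset⟩

namespace Data

variable {n m r nc nw q : ℕ} {S : Data n m r nc nw}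
  {Tz : Matrix (Fin r) (Fin q) ℝ} {Tu : Matrix (Fin m) (Fin q) ℝ}
  {K : Matrix (Fin m) (Fin q ⊕ Fin nc) ℝ}

theorem lipschitzWith_input (K : Matrix (Fin m) (Fin q ⊕ Fin nc) ℝ) :
    LipschitzWith (‖gain K‖₊ * 1) (input (n := n) K) :=
  (gain K).lipschitz.comp LipschitzWith.prod_snd

theorem exists_lipschitzWith_output (S : Data n m r nc nw) (K : Matrix (Fin m) (Fin q ⊕ Fin nc) ℝ) :
    ∃ L, ∀ w, LipschitzWith L (S.output K w) :=
  ⟨_, fun w ↦ (((mlin S.C).lipschitz.comp LipschitzWith.prod_fst).add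
    ((mlin S.D).lipschitz.comp (lipschitzWith_input K))).add (LipschitzWith.const (mlin S.Dw w))⟩

theorem exists_lipschitzOnWith_controllerField (S : Data n m r nc nw)
    (Tz : Matrix (Fin r) (Fin q) ℝ) (Tu : Matrix (Fin m) (Fin q) ℝ)
    (K : Matrix (Fin m) (Fin q ⊕ Fin nc) ℝ) (Lf Lg : NNReal) :
    ∃ L, ∀ w tu tz, LipschitzOnWith Lf (gradient S.f₀) tu → LipschitzOnWith Lg (gradient S.g₀) tz →
      LipschitzOnWith L (fun ξ ↦ S.controllerField Tz Tu w (input K ξ) (S.output K w ξ))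
        {ξ | input K ξ ∈ tu ∧ S.output K w ξ ∈ tz} := by
  obtain ⟨Lz, hz⟩ := S.exists_lipschitzWith_output K
  have hu := lipschitzWith_input (n := n) K
  have hviolation (w) := (((mlin S.Hz).lipschitz.comp (hz w)).add
    ((mlin S.Hu).lipschitz.comp hu)).add (LipschitzWith.const (mlin S.Hw w))
  exact ⟨_, fun w tu tz hf hg ↦
    (((mlin Tuᵀ).lipschitz.comp_lipschitzOnWith
        (hf.comp hu.lipschitzOnWith fun ξ hξ ↦ hξ.1)).add
      ((mlin Tzᵀ).lipschitz.comp_lipschitzOnWith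
        (hg.comp (hz w).lipschitzOnWith fun ξ hξ ↦ hξ.2))).neg.prodMk
      (hviolation w).neg.lipschitzOnWith⟩

theorem exists_isLocallyExpStable_closedLoop (hA : IsHurwitz S.A)
    {P : Matrix (Fin q ⊕ Fin nc) (Fin q ⊕ Fin nc) ℝ} (hP : P.PosDef) {ε : ℝ} (hε : 0 < ε)
    (h : ∀ w, IsStronglyDissipativeOn (matrixForm (pairVec q nc).toLinearMap P) ε
      (S.reducedField Tz Tu K w) (S.reducedDomain K w)) (Lf Lg : NNReal) :
    ∃ τ₀ > 0, ∀ τ : ℝ, τ₀ ≤ τ → ∀ w η tu tz, IsOpen tu → IsOpen tz → tu ⊆ interior S.Uset →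
      tz ⊆ interior S.Zset → LipschitzOnWith Lf (gradient S.f₀) tu →
      LipschitzOnWith Lg (gradient S.g₀) tz → gain K η ∈ tu → S.dcOutput w (gain K η) ∈ tz →
      S.reducedField Tz Tu K w η = 0 →
      IsLocallyExpStable (S.closedLoop Tz Tu K τ τ w) (S.domain K w) (S.steadyState K w η) := by
  obtain ⟨BX, hsymm, ⟨cX, hcX, hX⟩, α, hα, hBA⟩ := hA.exists_lyapunov_form
  obtain ⟨cH, hcH, hH⟩ := exists_pos_mul_norm_sq_le_matrixForm (pairVec q nc).injective hP
  obtain ⟨L, hL⟩ := S.exists_lipschitzOnWith_controllerField Tz Tu K Lf Lg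
  obtain ⟨Lz, hz⟩ := S.exists_lipschitzWith_output K
  obtain ⟨τ₀, hτ₀, hstable⟩ := exists_isLocallyExpStable_twoTimescale (S.dcGain K) hsymm
    (matrixForm_comm (isHermitian_iff_isSymm.1 hP.isHermitian)) hcX hcH hα hε hX hH hBA L
  refine ⟨τ₀, hτ₀, fun τ hτ w η tu tz htu htz htu' htz' hf hg hηu hηz hzero ↦ ?_⟩
  have hon (η') : S.controllerField Tz Tu w (input K (S.steadyState K w η'))
      (S.output K w (S.steadyState K w η')) = S.reducedField Tz Tu K w η' := by
    rw [output_steadyState]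
    rfl
  have hmem (η') : S.steadyState K w η' ∈ {ξ | input K ξ ∈ tu ∧ S.output K w ξ ∈ tz} ↔
      gain K η' ∈ tu ∧ S.dcOutput w (gain K η') ∈ tz := by
    rw [mem_ofPred_eq, output_steadyState]
    rfl
  rw [closedLoop_eq S Tz Tu K hA.isUnit_det]
  refine hstable τ hτ _ η (fun ξ ↦ S.controllerField Tz Tu w (input K ξ) (S.output K w ξ)) _ _
    (((htu.preimage (lipschitzWith_input K).continuous).inter
      (htz.preimage (hz w).continuous)).mem_nhds ((hmem η).2 ⟨hηu, hηz⟩))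
    (fun ξ hξ ↦ ⟨htu' hξ.1, htz' hξ.2⟩) (hL w tu tz hf hg) ((hon η).trans hzero) fun η' hη' ↦ ?_
  obtain ⟨hη'u, hη'z⟩ := (hmem η').1 hη'
  have hdiss := h w η' ⟨htu' hη'u, htz' hη'z⟩ η ⟨htu' hηu, htz' hηz⟩
  rw [hzero, sub_zero, ← hon η'] at hdiss
  exact hdiss

theorem continuousOn_of_reducedField_eq_zero
    {B : ControllerState q nc →L[ℝ] ControllerState q nc →L[ℝ] ℝ} {ε : ℝ} (hε : 0 < ε)
    (h : ∀ w, IsStronglyDissipativeOn B ε (S.reducedField Tz Tu K w) (S.reducedDomain K w))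
    (hg : ContinuousOn (gradient S.g₀) (interior S.Zset)) {T : Set (EuclideanSpace ℝ (Fin nw))}
    {e : EuclideanSpace ℝ (Fin nw) → ControllerState q nc}
    (hmem : ∀ w ∈ T, e w ∈ S.reducedDomain K w)
    (hzero : ∀ w ∈ T, S.reducedField Tz Tu K w (e w) = 0) : ContinuousOn e T := by
  have hdc (u) : Continuous fun w ↦ S.dcOutput w u :=
    continuous_const.add (mlin S.Gw).continuous
  refine IsStronglyDissipativeOn.continuousOn_of_eq_zero hε (fun w _ ↦ h w)
    (fun η ↦ isOpen_const.inter (isOpen_interior.preimage (hdc _))) (fun w η hη ↦ ?_) hmem hzero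
  have hgrad : ContinuousAt (fun w ↦ gradient S.g₀ (S.dcOutput w (gain K η))) w :=
    ContinuousAt.comp (f := fun w ↦ S.dcOutput w (gain K η))
      (hg.continuousAt (isOpen_interior.mem_nhds hη.2)) (hdc _).continuousAt
  have hviol : Continuous fun w ↦ S.violation w (gain K η) (S.dcOutput w (gain K η)) :=
    (((mlin S.Hz).continuous.comp (hdc _)).add continuous_const).add (mlin S.Hw).continuous
  exact (continuousAt_const.add ((mlin Tzᵀ).continuous.continuousAt.comp hgrad)).neg.prodMk
    hviol.neg.continuousAt

theorem exists_isLocallyExpStable_steadyState (hA : IsHurwitz S.A)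
    {P : Matrix (Fin q ⊕ Fin nc) (Fin q ⊕ Fin nc) ℝ} (hP : P.PosDef) {ε : ℝ} (hε : 0 < ε)
    (h : ∀ w, IsStronglyDissipativeOn (matrixForm (pairVec q nc).toLinearMap P) ε
      (S.reducedField Tz Tu K w) (S.reducedDomain K w))
    (hf : LocallyLipschitzOn (interior S.Uset) (gradient S.f₀))
    (hg : LocallyLipschitzOn (interior S.Zset) (gradient S.g₀))
    {T : Set (EuclideanSpace ℝ (Fin nw))} (hT : IsCompact T)
    {e : EuclideanSpace ℝ (Fin nw) → ControllerState q nc}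
    (hmem : ∀ w ∈ T, e w ∈ S.reducedDomain K w)
    (hzero : ∀ w ∈ T, S.reducedField Tz Tu K w (e w) = 0) :
    ∃ τ₀ > 0, ∀ τ : ℝ, τ₀ ≤ τ → ∀ w ∈ T,
      IsLocallyExpStable (S.closedLoop Tz Tu K τ τ w) (S.domain K w) (S.steadyState K w (e w)) := by
  have hu : ContinuousOn (fun w ↦ gain K (e w)) T := (gain K).continuous.comp_continuousOn
    (continuousOn_of_reducedField_eq_zero hε h hg.continuousOn hmem hzero)
  have hz : ContinuousOn (fun w ↦ S.dcOutput w (gain K (e w))) T :=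
    ((mlin S.Gu).continuous.comp_continuousOn hu).add (mlin S.Gw).continuous.continuousOn
  obtain ⟨Lf, tu, htu, hutu, htu', hLf⟩ := exists_isOpen_lipschitzOnWith_of_isCompact hf
    isOpen_interior (hT.image_of_continuousOn hu) (image_subset_iff.2 fun w hw ↦ (hmem w hw).1)
  obtain ⟨Lg, tz, htz, hztz, htz', hLg⟩ := exists_isOpen_lipschitzOnWith_of_isCompact hg
    isOpen_interior (hT.image_of_continuousOn hz) (image_subset_iff.2 fun w hw ↦ (hmem w hw).2)
  obtain ⟨τ₀, hτ₀, hstable⟩ := exists_isLocallyExpStable_closedLoop hA hP hε h Lf Lg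
  exact ⟨τ₀, hτ₀, fun τ hτ w hw ↦ hstable τ hτ w (e w) tu tz htu htz htu' htz' hLf hLg
    (hutu (mem_image_of_mem _ hw)) (hztz (mem_image_of_mem _ hw)) (hzero w hw)⟩

end Data

end OSS

end

theorem mainTheorem3_general {n m r nc nw q : ℕ} {S : OSS.Data n m r nc nw}
    (hA : OSS.IsHurwitz S.A)
    (hdiff_f : DifferentiableOn ℝ S.f₀ (interior S.Uset))
    (hdiff_g : DifferentiableOn ℝ S.g₀ (interior S.Zset))
    (hlip_f : LocallyLipschitzOn (interior S.Uset) (gradient S.f₀))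
    (hlip_g : LocallyLipschitzOn (interior S.Zset) (gradient S.g₀))
    (hW : IsCompact S.Wset)
    (hopt : ∀ w ∈ S.Wset, ∃ u ∈ interior S.Uset, ∃ z ∈ interior S.Zset, S.IsOptimal w u z)
    {Tz : Matrix (Fin r) (Fin q) ℝ} {Tu : Matrix (Fin m) (Fin q) ℝ}
    (hT : S.SpansConstraintKernel Tz Tu)
    {Δ₁ : EuclideanSpace ℝ (Fin m) → EuclideanSpace ℝ (Fin m)}
    {Δ₂ : EuclideanSpace ℝ (Fin r) → EuclideanSpace ℝ (Fin r)}
    {Q₁ : Matrix (Fin m) (Fin m) ℝ} {Q₂ : Matrix (Fin r) (Fin r) ℝ}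
    (hf : ∀ v ∈ interior S.Uset, gradient S.f₀ v = toEuclideanLin Q₁ v + Δ₁ v)
    (hg : ∀ v ∈ interior S.Zset, gradient S.g₀ v = toEuclideanLin Q₂ v + Δ₂ v)
    {Θ₁ : Matrix (Fin m ⊕ Fin m) (Fin m ⊕ Fin m) ℝ}
    {Θ₂ : Matrix (Fin r ⊕ Fin r) (Fin r ⊕ Fin r) ℝ}
    (hΘ₁ : OSS.IsSectorMultiplier (interior S.Uset) Δ₁ Θ₁)
    (hΘ₂ : OSS.IsSectorMultiplier (interior S.Zset) Δ₂ Θ₂) {ρ γ : ℝ}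
    {Y : Matrix (Fin q ⊕ Fin nc) (Fin q ⊕ Fin nc) ℝ}
    {Z : Matrix (Fin m) (Fin q ⊕ Fin nc) ℝ} {θ₁ θ₂ : ℝ}
    (hLMI : S.SynthesisLMI Tz Tu Q₁ Q₂ Θ₁ Θ₂ ρ γ Y Z θ₁ θ₂) :
    ∃ τ₀ > 0, ∀ τ : ℝ, τ₀ ≤ τ → S.SolvesOSS Tz Tu (Z * Y⁻¹) τ τ := by
  obtain ⟨ε, hε, hdiss⟩ := hLMI.exists_isStronglyDissipativeOn hf hg hΘ₁ hΘ₂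
  have hK := hT.gain_surjective (hLMI.gain_injective hΘ₁ hΘ₂)
  choose! η hmem hzero hoptimal using fun w hw ↦
    hT.exists_isOptimal_reducedField_eq_zero hK hdiff_f hdiff_g (hopt w hw)
  obtain ⟨τ₀, hτ₀, hstable⟩ := OSS.Data.exists_isLocallyExpStable_steadyState hA hLMI.1.inv hε
    hdiss hlip_f hlip_g hW hmem hzero
  refine ⟨τ₀, hτ₀, fun τ hτ w hw ↦ ?_⟩
  have hequilibrium {p} := S.isEquilibrium_closedLoop_iff Tz Tu (Z * Y⁻¹) hA.isUnit_det
    (hτ₀.trans_le hτ).ne' (w := w) (p := p)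
  refine ⟨S.steadyState (Z * Y⁻¹) w (η w), hequilibrium.2 ⟨rfl, hmem w hw, hzero w hw⟩,
    fun p hp ↦ ?_, hstable τ hτ w hw, ?_⟩
  · obtain ⟨hp₁, hpmem, hpzero⟩ := hequilibrium.1 hp
    rw [hp₁, (hdiss w).eq_of_eq_zero hε hpmem (hmem w hw) hpzero (hzero w hw)]
  · rw [OSS.Data.output_steadyState]
    exact hoptimal w hw

theorem mainTheorem3 {n m r nc nw q : ℕ} (S : OSS.Data n m r nc nw)
    (hS : S.StandingAssumptions)
    (Tz : Matrix (Fin r) (Fin q) ℝ) (Tu : Matrix (Fin m) (Fin q) ℝ)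
    (hT : S.SpansConstraintKernel Tz Tu)
    (ft : EuclideanSpace ℝ (Fin m) → ℝ) (gt : EuclideanSpace ℝ (Fin r) → ℝ)
    (Q₁ : Matrix (Fin m) (Fin m) ℝ) (Q₂ : Matrix (Fin r) (Fin r) ℝ)
    (hf : OSS.IsQuadraticSplit S.Uset S.f₀ ft Q₁)
    (hg : OSS.IsQuadraticSplit S.Zset S.g₀ gt Q₂)
    (Θ₁ : Matrix (Fin m ⊕ Fin m) (Fin m ⊕ Fin m) ℝ)
    (Θ₂ : Matrix (Fin r ⊕ Fin r) (Fin r ⊕ Fin r) ℝ)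
    (hΘ₁ : OSS.IsSectorMultiplier (interior S.Uset) (gradient ft) Θ₁)
    (hΘ₂ : OSS.IsSectorMultiplier (interior S.Zset) (gradient gt) Θ₂)
    (ρ γ : ℝ) (hρ : 0 < ρ) (hγ : 0 < γ)
    (Y : Matrix (Fin q ⊕ Fin nc) (Fin q ⊕ Fin nc) ℝ)
    (Z : Matrix (Fin m) (Fin q ⊕ Fin nc) ℝ) (θ₁ θ₂ : ℝ)
    (hLMI : S.SynthesisLMI Tz Tu Q₁ Q₂ Θ₁ Θ₂ ρ γ Y Z θ₁ θ₂) :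
    ∃ τ₀ > 0, ∀ τ : ℝ, τ₀ ≤ τ → S.SolvesOSS Tz Tu (Z * Y⁻¹) τ τ :=
  mainTheorem3_general hS.hurwitz (hS.contDiff_f.differentiableOn one_ne_zero)
    (hS.contDiff_g.differentiableOn one_ne_zero) hS.lipschitz_f hS.lipschitz_g hS.compact_W
    hS.exists_optimal hT (fun v hv ↦ (hf.2.2 v hv).2) (fun v hv ↦ (hg.2.2 v hv).2) hΘ₁ hΘ₂ hLMI
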